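/- Let $V$ be a real vector space of dimension $4n$, $n\ge 2$, with a nondegenerate symmetric bilinear form $g$. Put $\epsilon_1=1$, $\epsilon_2=\epsilon_3=-1$. A triple $\mathfrak H=(J_1,J_2,J_3)$ of endomorphisms of $V$ is a para-hypercomplex structure if $J_\alpha^2=-\epsilon_\alpha\,\mathrm{Id}$ and $J_\beta J_\gamma=-\epsilon_\alpha J_\alpha$ for every cyclic permutation $(\alpha,\beta,\gamma)$ of $(1,2,3)$. Let $\mathfrak G\subset\mathrm{End}(V)$ be a Lie subalgebra which is a para-quaternionic structure hermitian for $g$, i.e. $\mathfrak G$ has a basis that is a para-hypercomplex structure consisting of $g$-skew-symmetric endomorphisms, and let $\mathfrak H=(J_1,J_2,J_3)$ be any para-hypercomplex structure that is a basis of $\mathfrak G$. Let $$aut(\mathfrak G)=\{L\in \mathrm{End}(V) : [L,\mathfrak G]\subset\mathfrak G\},$$ let $sp(\mathfrak G)\cong sp(n,\mathbb R)\oplus sp(1,\mathbb R)$ be the algebra of $g$-skew-symmetric elements of $aut(\mathfrak G)$, and let $sp(\mathfrak H)\cong sp(n,\mathbb R)$ be the algebra of those elements of $sp(\mathfrak G)$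 which commute with $J_1,J_2,J_3$. For a Lie subalgebra $\mathfrak L\subset\mathrm{End}(V)$ let $\mathcal R(\mathfrak L)$ be the space of $\mathfrak L$-valued $2$-forms $R$ on $V$ with $R(X,Y)Z+R(Y,Z)X+R(Z,X)Y=0$. Let $\mathrm{Ric}(R)(Y,Z)=\mathrm{Tr}(X\mapsto R(X,Y)Z)$, let $K(R)$ be the trace of $\mathrm{Ric}(R)$ with respect to $g$ (the scalar curvature), and let $\mathcal W=\{R\in\mathcal R(aut(\mathfrak G)) : \mathrm{Ric}(R)=0\}$ (the Weyl part). An endomorphism $A\in sp(\mathfrak G)$ acts on $\mathrm{End}(V)$-valued bilinear maps by $(A\cdot R)(X,Y)=[A,R(X,Y)]-R(AX,Y)-R(X,AY)$. Let $$R_{\tilde{\mathbb H}P^n}(X,Y)Z=g(Y,Z)X-g(X,Z)Y+\sum_{\alpha}\epsilon_\alpha\bigl(g(J_\alpha Y,Z)J_\alpha X-g(J_\alpha X,Z)J_\alpha Y\bigr)-2\sum_\alpha\epsilon_\alpha\, g(J_\alpha X,Y)J_\alpha Z$$ be the curvature tensor of the para-quaternionic projective space $\tilde{\mathbb H}P^n$.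 Then: i) Every $R\in\mathcal R(sp(\mathfrak G))$ is Einstein: $\mathrm{Ric}(R)=\dfrac{K(R)}{4n}\,g$. ii) $\mathcal R(sp(\mathfrak G))=\mathbb R\, R_{\tilde{\mathbb H}P^n}\oplus\mathcal R(sp(\mathfrak H))$, where both summands are irreducible (in particular nonzero) $sp(\mathfrak G)$-submodules, and $\mathcal R(sp(\mathfrak H))\subset\mathcal W$. -/

import Mathlib

-- The commutator bracket on an associative ring, here used on `End V`.
attribute [local instance 100] LieRing.ofAssociativeRing

noncomputable section

namespace ParaQuaternionic

section Structures

/-- The signs `ε₁ = 1`, `ε₂ = ε₃ = -1`; the index set `{1, 2, 3}` is modelled by `Fin 3`. -/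
def eps : Fin 3 → ℝ := ![1, -1, -1]

variable {V : Type*} [AddCommGroup V] [Module ℝ V]

/-- A para-hypercomplex structure: `J_β J_γ = -ε_α J_α` for each cyclic permutation `(α, β, γ)` of
the three indices, and `J_α² = -ε_α Id`. Addition in `Fin 3` is cyclic. -/
structure IsParaHypercomplex (J : Fin 3 → Module.End ℝ V) : Prop where
  mul_cyclic : ∀ α : Fin 3, J (α + 1) * J (α + 2) = -(eps α • J α)
  mul_self : ∀ α : Fin 3, J α * J α = -(eps α • (1 : Module.End ℝ V))

/-- The para-quaternionic structure `G` and the para-hypercomplex structure `J` correspond to each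
other: `J` satisfies the para-hypercomplex relations and is a basis of the Lie algebra
`G ⊆ End V`. -/
structure Corresponds (G : LieSubalgebra ℝ (Module.End ℝ V)) (J : Fin 3 → Module.End ℝ V) :
    Prop where
  isParaHypercomplex : IsParaHypercomplex J
  linearIndependent : LinearIndependent ℝ J
  span_eq : Submodule.span ℝ (Set.range J) = G.toSubmodule

/-- A para-hypercomplex structure is hermitian for `g` if its endomorphisms are `g`-skew. -/
def IsHermitianTriple (g : LinearMap.BilinForm ℝ V) (J : Fin 3 → Module.End ℝ V) : Prop :=
  ∀ (α : Fin 3) (X Y : V), g (J α X) Y = -g X (J α Y)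

/-- `G` is a para-quaternionic structure on `V` which is hermitian with respect to `g`: some
corresponding para-hypercomplex structure exists and is hermitian. -/
def IsHermitianParaQuaternionic (g : LinearMap.BilinForm ℝ V)
    (G : LieSubalgebra ℝ (Module.End ℝ V)) : Prop :=
  ∃ J : Fin 3 → Module.End ℝ V, Corresponds G J ∧ IsHermitianTriple g J

/-- The algebra `aut(G)` of para-quaternionic endomorphisms, the normalizer of `G` in `End V`. -/
def autG (G : LieSubalgebra ℝ (Module.End ℝ V)) : LieSubalgebra ℝ (Module.End ℝ V) where
  carrier := {L | ∀ J ∈ G, ⁅L, J⁆ ∈ G}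
  add_mem' := fun {A B} hA hB J hJ => by
    rw [add_lie]; exact G.add_mem (hA J hJ) (hB J hJ)
  zero_mem' := fun J _ => by rw [zero_lie]; exact G.zero_mem
  smul_mem' := fun c A hA J hJ => by rw [smul_lie]; exact G.smul_mem c (hA J hJ)
  lie_mem' := fun {A B} hA hB J hJ => by
    rw [lie_lie]; exact G.sub_mem (hA _ (hB J hJ)) (hB _ (hA J hJ))

/-- The algebra `aut(H)` of para-hypercomplex endomorphisms, those which commute with all `J_α`. -/
def autH (J : Fin 3 → Module.End ℝ V) : LieSubalgebra ℝ (Module.End ℝ V) where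
  carrier := {L | ∀ α, ⁅L, J α⁆ = 0}
  add_mem' := fun {A B} hA hB α => by rw [add_lie, hA α, hB α, add_zero]
  zero_mem' := fun α => zero_lie _
  smul_mem' := fun c A hA α => by rw [smul_lie, hA α, smul_zero]
  lie_mem' := fun {A B} hA hB α => by
    rw [lie_lie, hA α, hB α, lie_zero, lie_zero, sub_zero]

/-- `sp(G)`, isomorphic to `sp(n, ℝ) ⊕ sp(1, ℝ)`: the `g`-skew elements of `aut(G)`. -/
def spG (g : LinearMap.BilinForm ℝ V) (G : LieSubalgebra ℝ (Module.End ℝ V)) :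
    LieSubalgebra ℝ (Module.End ℝ V) :=
  autG G ⊓ skewAdjointLieSubalgebra g

/-- `sp(H) = aut(H) ∩ sp(G)`, isomorphic to `sp(n, ℝ)`. -/
def spH (g : LinearMap.BilinForm ℝ V) (G : LieSubalgebra ℝ (Module.End ℝ V))
    (J : Fin 3 → Module.End ℝ V) : LieSubalgebra ℝ (Module.End ℝ V) :=
  autH J ⊓ spG g G

theorem mem_spG (g : LinearMap.BilinForm ℝ V) (G : LieSubalgebra ℝ (Module.End ℝ V))
    (A : Module.End ℝ V) :
    A ∈ spG g G ↔ (∀ J ∈ G, ⁅A, J⁆ ∈ G) ∧ ∀ X Y : V, g (A X) Y = -g X (A Y) := by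
  refine and_congr Iff.rfl ?_
  refine (LinearMap.mem_skewAdjointSubmodule (B := g) A).trans ?_
  constructor
  · intro h X Y
    simpa using h X Y
  · intro h X Y
    simpa using h X Y

end Structures

section CurvatureTensors

variable {V : Type*} [AddCommGroup V] [Module ℝ V]

/-- Bilinear maps `V × V → End V`, `(X, Y) ↦ R(X, Y)`. Every Lie subalgebra of `End V` acts on
them in the natural way, see `lie_curv_apply`. -/
abbrev Curv (V : Type*) [AddCommGroup V] [Module ℝ V] : Type _ := V →ₗ[ℝ] V →ₗ[ℝ] Module.End ℝ V

/-- The action of `L ⊆ End V` on `Curv V` provided by Mathlib is the natural one. -/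
theorem lie_curv_apply (L : LieSubalgebra ℝ (Module.End ℝ V)) (A : L) (R : Curv V) (X Y Z : V) :
    ⁅A, R⁆ X Y Z = A.1 (R X Y Z) - R (A.1 X) Y Z - R X (A.1 Y) Z - R X Y (A.1 Z) := by
  have h1 : ⁅A, R⁆ X Y = ⁅A.1, R X Y⁆ - R X (A.1 Y) - R (A.1 X) Y := by
    rw [LieHom.lie_apply, LinearMap.sub_apply, LieHom.lie_apply]
    rfl
  rw [h1, LinearMap.sub_apply, LinearMap.sub_apply, Ring.lie_def, LinearMap.sub_apply,
    Module.End.mul_apply, Module.End.mul_apply]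
  abel

/-- The space `𝓡(L)` of curvature tensors of type `L`: the alternating `L`-valued `2`-forms on `V`
which satisfy the Bianchi identity. -/
def curvatureTensors (L : LieSubalgebra ℝ (Module.End ℝ V)) : Submodule ℝ (Curv V) where
  carrier := {R | (∀ X, R X X = 0) ∧ (∀ X Y, R X Y ∈ L) ∧
    ∀ X Y Z, R X Y Z + R Y Z X + R Z X Y = 0}
  add_mem' := fun {R S} hR hS => by
    refine ⟨fun X => ?_, fun X Y => ?_, fun X Y Z => ?_⟩
    · simp [hR.1 X, hS.1 X]
    · exact L.add_mem (hR.2.1 X Y) (hS.2.1 X Y)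
    · have h1 := hR.2.2 X Y Z
      have h2 := hS.2.2 X Y Z
      calc _ = (R X Y Z + R Y Z X + R Z X Y) + (S X Y Z + S Y Z X + S Z X Y) := by
            simp only [LinearMap.add_apply]; abel
        _ = 0 := by rw [h1, h2, add_zero]
  zero_mem' := ⟨fun _ => rfl, fun _ _ => L.zero_mem, fun _ _ _ => by simp⟩
  smul_mem' := fun c R hR => by
    refine ⟨fun X => ?_, fun X Y => L.smul_mem c (hR.2.1 X Y), fun X Y Z => ?_⟩
    · simp [hR.1 X]
    · have h1 := hR.2.2 X Y Z
      simp only [LinearMap.smul_apply, ← smul_add, h1, smul_zero]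

/-- The Ricci tensor `Ric(R)(Y, Z) = Tr (X ↦ R(X, Y) Z)`, linear in `R`. -/
def ricci : Curv V →ₗ[ℝ] LinearMap.BilinForm ℝ V where
  toFun R := LinearMap.mk₂ ℝ (fun Y Z => LinearMap.trace ℝ V ((R.flip Y).flip Z))
    (fun Y Y' Z => by rw [← map_add]; congr 1; ext X; simp)
    (fun c Y Z => by rw [← map_smul]; congr 1; ext X; simp)
    (fun Y Z Z' => by rw [map_add, map_add])
    (fun c Y Z => by rw [map_smul, map_smul])
  map_add' R S := by
    ext Y Z
    simp only [LinearMap.mk₂_apply, LinearMap.add_apply]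
    rw [← map_add]; congr 1
  map_smul' c R := by
    ext Y Z
    simp only [LinearMap.mk₂_apply, LinearMap.smul_apply, RingHom.id_apply]
    rw [← map_smul]; congr 1

/-- The scalar curvature `K(R)`: the trace, with respect to the nondegenerate form `g`, of the
Ricci tensor, i.e. the trace of the endomorphism `ρ` with `g (ρ Y) Z = Ric(R)(Y, Z)`. -/
def scalarCurvature [FiniteDimensional ℝ V] (g : LinearMap.BilinForm ℝ V) (hg : g.Nondegenerate)
    (R : Curv V) : ℝ :=
  LinearMap.trace ℝ V ((g.toDual hg).symm.toLinearMap ∘ₗ ricci R)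

/-- The Weyl part `𝓦`: the kernel of the Ricci map on `𝓡(aut(G))`. -/
def weylPart (G : LieSubalgebra ℝ (Module.End ℝ V)) : Submodule ℝ (Curv V) :=
  curvatureTensors (autG G) ⊓ LinearMap.ker ricci

/-- `N` is an irreducible `L`-submodule of `Curv V`: it is stable under the action of `L`, it is
nonzero, and its only `L`-submodules are `0` and `N`. -/
def IsIrreducibleSubmodule (L : LieSubalgebra ℝ (Module.End ℝ V)) (N : Submodule ℝ (Curv V)) :
    Prop :=
  ∃ N' : LieSubmodule ℝ L (Curv V), N'.toSubmodule = N ∧ LieModule.IsIrreducible ℝ L N'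

/-- The curvature tensor of the para-quaternionic projective space `ℍ̃Pⁿ`, carried over to a vector
space with a hermitian para-hypercomplex structure (`tangentMatrix_projectiveCurvature` below checks
the formula against the symmetric space `ℍ̃Pⁿ`):
`R(X, Y)Z = g(Y, Z)X - g(X, Z)Y + ∑ ε_α (g(J_α Y, Z) J_α X - g(J_α X, Z) J_α Y)`
`- 2 ∑ ε_α g(J_α X, Y) J_α Z`. -/
def projectiveCurvature (g : LinearMap.BilinForm ℝ V) (J : Fin 3 → Module.End ℝ V) : Curv V :=
  LinearMap.mk₂ ℝ
    (fun X Y => (g Y).smulRight X - (g X).smulRight Y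
      + ∑ α, eps α • ((g (J α Y)).smulRight (J α X) - (g (J α X)).smulRight (J α Y))
      - (2 : ℝ) • ∑ α, (eps α * g (J α X) Y) • J α)
    (fun X X' Y => by
      ext Z
      simp [Fin.sum_univ_three]
      module)
    (fun c X Y => by
      ext Z
      simp [Fin.sum_univ_three]
      module)
    (fun X Y Y' => by
      ext Z
      simp [Fin.sum_univ_three]
      module)
    (fun c X Y => by
      ext Z
      simp [Fin.sum_univ_three]
      module)

theorem projectiveCurvature_apply (g : LinearMap.BilinForm ℝ V) (J : Fin 3 → Module.End ℝ V)
    (X Y Z : V) :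
    projectiveCurvature g J X Y Z = g Y Z • X - g X Z • Y
      + ∑ α, eps α • (g (J α Y) Z • J α X - g (J α X) Z • J α Y)
      - (2 : ℝ) • ∑ α, (eps α * g (J α X) Y) • J α Z := by
  simp [projectiveCurvature, Fin.sum_univ_three]

end CurvatureTensors

section ProjectiveSpace

open scoped Quaternion

/-- The algebra of para-quaternions: `i² = -1`, `j² = k² = 1`, with `k = j i = -i j`. -/
abbrev ParaQuat : Type := ℍ[ℝ, -1, 0, 1]

/-- The units `i, j, k` of the para-quaternions, with `k = j i`. -/
def imUnit : Fin 3 → ParaQuat := ![⟨0, 1, 0, 0⟩, ⟨0, 0, 1, 0⟩, ⟨0, 0, 0, -1⟩]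

/-- The scalar product `Re ∑ conj(u_m) v_m`, of signature `(2n, 2n)`, on `ℍ̃ⁿ`. -/
def stdForm (n : ℕ) : LinearMap.BilinForm ℝ (Fin n → ParaQuat) :=
  LinearMap.mk₂ ℝ (fun u v => ∑ m, (star (u m) * v m).re)
    (fun u u' v => by
      rw [← Finset.sum_add_distrib]; refine Finset.sum_congr rfl fun m _ => ?_
      simp; ring)
    (fun c u v => by
      rw [smul_eq_mul, Finset.mul_sum]; refine Finset.sum_congr rfl fun m _ => ?_
      simp)
    (fun u v v' => by
      rw [← Finset.sum_add_distrib]; refine Finset.sum_congr rfl fun m _ => ?_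
      simp; ring)
    (fun c u v => by
      rw [smul_eq_mul, Finset.mul_sum]; refine Finset.sum_congr rfl fun m _ => ?_
      simp)

/-- Right multiplication by `i, j, k` on `ℍ̃ⁿ`. -/
def stdJ (n : ℕ) (α : Fin 3) : Module.End ℝ (Fin n → ParaQuat) where
  toFun u m := u m * imUnit α
  map_add' u v := by ext1 m; exact add_mul _ _ _
  map_smul' c u := by ext1 m; exact smul_mul_assoc c (u m) (imUnit α)

theorem stdJ_isParaHypercomplex (n : ℕ) : IsParaHypercomplex (stdJ n) where
  mul_cyclic α := by
    fin_cases α <;> ext u m <;> simp [stdJ, imUnit, eps]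
  mul_self α := by
    fin_cases α <;> ext u m <;> simp [stdJ, imUnit, eps]

theorem stdJ_isHermitianTriple (n : ℕ) : IsHermitianTriple (stdForm n) (stdJ n) := by
  intro α X Y
  simp only [stdForm, stdJ, LinearMap.mk₂_apply, LinearMap.coe_mk, AddHom.coe_mk,
    ← Finset.sum_neg_distrib]
  refine Finset.sum_congr rfl fun m _ => ?_
  fin_cases α <;> simp [imUnit] <;> ring

/-- The tangent vector `u ∈ ℍ̃ⁿ` of `ℍ̃Pⁿ` at `[1, 0, …, 0]`, as an element of the complement `m` in
the symmetric decomposition `sp(n+1, ℝ) = m + (sp(n, ℝ) ⊕ sp(1, ℝ))`, the elements of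
`sp(n+1, ℝ)` being the skew-hermitian para-quaternionic matrices. -/
def tangentMatrix {n : ℕ} (u : Fin n → ParaQuat) :
    Matrix (Unit ⊕ Fin n) (Unit ⊕ Fin n) ParaQuat :=
  Matrix.fromBlocks 0 (-Matrix.replicateRow Unit (star u)) (Matrix.replicateCol Unit u) 0

theorem sum_star_mul {n : ℕ} (u v : Fin n → ParaQuat) :
    ∑ m, star (u m) * v m = (stdForm n u v) • (1 : ParaQuat)
      + ∑ α, (eps α * stdForm n (stdJ n α u) v) • imUnit α := by
  have key : ∀ a b : ParaQuat, star a * b = (star a * b).re • (1 : ParaQuat)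
      + ∑ α, (eps α * (star (a * imUnit α) * b).re) • imUnit α := by
    intro a b
    ext <;> simp [imUnit, eps, Fin.sum_univ_three] <;> ring
  rw [Finset.sum_congr rfl fun m _ => key (u m) (v m)]
  simp only [stdForm, stdJ, LinearMap.mk₂_apply, LinearMap.coe_mk, AddHom.coe_mk,
    Finset.sum_add_distrib, Finset.sum_smul, Finset.mul_sum]
  rw [Finset.sum_comm]

theorem stdForm_comm {n : ℕ} (u v : Fin n → ParaQuat) : stdForm n u v = stdForm n v u := by
  simp only [stdForm, LinearMap.mk₂_apply]
  refine Finset.sum_congr rfl fun m _ => ?_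
  simp; ring

theorem projectiveCurvature_std {n : ℕ} (u v w : Fin n → ParaQuat) (m : Fin n) :
    projectiveCurvature (stdForm n) (stdJ n) u v w m =
      u m * (∑ l, star (v l) * w l) - v m * (∑ l, star (u l) * w l)
        - w m * (∑ l, star (u l) * v l - ∑ l, star (v l) * u l) := by
  have h : ∀ α, stdForm n (stdJ n α v) u = - stdForm n (stdJ n α u) v := fun α => by
    rw [stdJ_isHermitianTriple, stdForm_comm v]
  simp only [sum_star_mul, projectiveCurvature_apply, h, stdForm_comm v u, Fin.sum_univ_three]
  simp only [Pi.sub_apply, Pi.add_apply, Pi.smul_apply, stdJ, LinearMap.coe_mk, AddHom.coe_mk,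
    mul_add, mul_sub, mul_smul_comm, mul_one]
  module

/-- `projectiveCurvature` is the curvature tensor of the symmetric space
`ℍ̃Pⁿ = Sp(n+1, ℝ) / Sp(1, ℝ)·Sp(n, ℝ)`: on `ℍ̃ⁿ ≅ m` one has `R(u, v) w = -[[u, v], w]`. -/
theorem tangentMatrix_projectiveCurvature {n : ℕ} (u v w : Fin n → ParaQuat) :
    tangentMatrix (projectiveCurvature (stdForm n) (stdJ n) u v w) =
      -⁅⁅tangentMatrix u, tangentMatrix v⁆, tangentMatrix w⁆ := by
  refine Matrix.ext fun a b => ?_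
  rcases a with a | a <;> rcases b with b | b
  · simp [tangentMatrix, Ring.lie_def, Matrix.mul_apply, Matrix.sub_apply]
  · simp [tangentMatrix, Ring.lie_def, Matrix.mul_apply, projectiveCurvature_std,
      Finset.mul_sum, mul_sub, sub_mul, mul_assoc]
    abel
  · simp [tangentMatrix, Ring.lie_def, Matrix.mul_apply, projectiveCurvature_std,
      Finset.mul_sum, mul_sub, sub_mul, mul_assoc]
    abel
  · simp [tangentMatrix, Ring.lie_def, Matrix.mul_apply, Matrix.sub_apply]
end ProjectiveSpace

end ParaQuaternionic

end

/-! Let `I`, `P` be the first two members of the triple, so that the third is `I * P`. The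
`+1`-eigenspace `E` of `P` and its image `I E` are `g`-isotropic, `V = E ⊕ I E`, and `ω(x, y) = g (I
x) y` is a symplectic form on `E`, of dimension `2n ≥ 4`. Restriction to `E` identifies `sp(H)` with
`sp(E, ω)`, and averaging over the units gives `sp(G) = sp(H) ⊕ G`.

Splitting. Let `R` be of type `sp(G)`. Pair symmetry forces `R x y = ω(x, y) C` for `x`, `y` in `E`,
with one fixed endomorphism `C`. The Bianchi identity on `E`, with `dim E ≥ 4`, shows that `C` kills
`E`, so `C` is a multiple of the null element `I - I * P` of `G` (`exists_null_coefficient`).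
Running this for `P`, `-P`, `I * P`, `-I * P` fixes the `G`-part of `R` up to one constant
(`exists_coefficient`). The `G`-part of the projective tensor is of this kind and nonzero, so
subtracting a multiple of that tensor leaves type `sp(H)`.

Ricci. Tensors of type `sp(H)` are Ricci flat (`ricci_eq_zero`), while the projective one has Ricci
tensor `(4n + 8) g`. Hence the sum is direct and every tensor of type `sp(G)` is Einstein.

Irreducibility. A tensor of type `sp(H)` amounts to the quartic form `g (R e (I e) e) (I e)` on `E`,
so the module is `S⁴E`. The fourth power of the nilpotent `e² ∈ sp(E)` sends `R` to a multiple of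
`e⁴` (`lie_nullEnd_pow_four`). A nonzero submodule thus contains one `e⁴`, hence all of them, and a
pairing argument shows that they span. -/

namespace ParaQuaternionic

/-! ### Linear algebra of the eigenspaces of `P`, and pair symmetry -/

section HermitianPair

variable {V : Type*} [AddCommGroup V] [Module ℝ V]

/-- The generators `I = J₁`, `P = J₂` of a hermitian para-hypercomplex structure; the third
endomorphism is `J₃ = I P`. -/
structure HermitianPair (g : LinearMap.BilinForm ℝ V) (I P : Module.End ℝ V) : Prop where
  symm : ∀ x y, g x y = g y x
  eq_zero : ∀ x, (∀ y, g x y = 0) → x = 0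
  I_I : ∀ x, I (I x) = -x
  P_P : ∀ x, P (P x) = x
  P_I : ∀ x, P (I x) = -I (P x)
  skew_I : ∀ x y, g (I x) y = -g x (I y)
  skew_P : ∀ x y, g (P x) y = -g x (P y)

/-- `S` is a `g`-skew endomorphism commuting with `I` and `P`. -/
structure IsSymplectic (g : LinearMap.BilinForm ℝ V) (I P S : Module.End ℝ V) : Prop where
  comm_I : ∀ x, S (I x) = I (S x)
  comm_P : ∀ x, S (P x) = P (S x)
  skew : ∀ x y, g (S x) y = -g x (S y)

variable {g : LinearMap.BilinForm ℝ V} {I P S : Module.End ℝ V}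

theorem IsSymplectic.of_neg (h : IsSymplectic g I P S) : IsSymplectic g I (-P) S :=
  ⟨h.comm_I, fun x => by simp [h.comm_P], h.skew⟩

theorem IsSymplectic.mul (h : IsSymplectic g I P S) : IsSymplectic g I (I * P) S :=
  ⟨h.comm_I, fun x => by simp [h.comm_P, h.comm_I], h.skew⟩

namespace HermitianPair

theorem neg (h : HermitianPair g I P) : HermitianPair g I (-P) where
  symm := h.symm
  eq_zero := h.eq_zero
  I_I := h.I_I
  P_P x := by simp [h.P_P]
  P_I x := by simp [h.P_I]
  skew_I := h.skew_I
  skew_P x y := by simp [h.skew_P]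

theorem mul (h : HermitianPair g I P) : HermitianPair g I (I * P) where
  symm := h.symm
  eq_zero := h.eq_zero
  I_I := h.I_I
  P_P x := by simp [h.P_P, h.P_I, h.I_I]
  P_I x := by simp [h.P_I]
  skew_I := h.skew_I
  skew_P x y := by simp [h.skew_P, h.skew_I, h.P_I]

theorem isotropic (h : HermitianPair g I P) {x y : V} (hx : P x = x) (hy : P y = y) :
    g x y = 0 := by
  have := h.skew_P x y
  rw [hx, hy] at this
  linarith

theorem isotropic_I (h : HermitianPair g I P) {x y : V} (hx : P x = x) (hy : P y = y) :
    g (I x) (I y) = 0 := by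
  rw [h.skew_I, h.I_I, map_neg, h.isotropic hx hy]; simp

theorem form_skew (h : HermitianPair g I P) (x y : V) : g (I x) y = -g (I y) x := by
  rw [h.skew_I, h.symm]

theorem form_skew_P (h : HermitianPair g I P) (x y : V) : g (P x) y = -g (P y) x := by
  rw [h.skew_P, h.symm]

theorem form_skew_I_P (h : HermitianPair g I P) (x y : V) :
    g (I (P x)) y = -g (I (P y)) x := by
  rw [h.skew_I, h.skew_P, h.P_I, h.symm]; simp

theorem form_self (h : HermitianPair g I P) (x : V) : g (I x) x = 0 := by
  have := h.form_skew x x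
  linarith

/-- Every vector splits along the two eigenspaces of `P`, the second being the image under `I` of
the first. -/
theorem exists_split (h : HermitianPair g I P) (x : V) :
    ∃ u v, P u = u ∧ P v = v ∧ x = u + I v := by
  -- The eigencomponents of `x` are `(x ± P x) / 2`; the second is multiplied by `-I`, which `I`
  -- undoes.
  refine ⟨(1 / 2 : ℝ) • (x + P x), -(1 / 2 : ℝ) • I (x - P x), ?_, ?_, ?_⟩
  · simp [h.P_P, add_comm]
  · simp [h.P_P, h.P_I]; module
  · simp [h.I_I]; module

/-- Nondegeneracy of `ω` on `E`: since `I E` is isotropic, `I x` pairs trivially with `I E`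
automatically, so testing on `E` suffices. -/
theorem eq_zero_of_fixed (h : HermitianPair g I P) {x : V} (hx : P x = x)
    (hz : ∀ y, P y = y → g (I x) y = 0) : x = 0 := by
  have : I x = 0 := by
    refine h.eq_zero _ fun y => ?_
    obtain ⟨u, v, hu, hv, rfl⟩ := h.exists_split y
    rw [map_add, hz u hu, h.isotropic_I hx hv, add_zero]
  have h2 := h.I_I x
  rw [this, map_zero] at h2
  exact (neg_eq_zero.1 h2.symm)

theorem exists_form_eq_one (h : HermitianPair g I P) {x : V} (hx : P x = x) (h0 : x ≠ 0) :
    ∃ y, P y = y ∧ g (I x) y = 1 := by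
  by_contra! hc
  refine h0 (h.eq_zero_of_fixed hx fun y hy => ?_)
  by_contra hne
  exact hc ((g (I x) y)⁻¹ • y) (by simp [hy]) (by simp [hne])

/-- In dimension at least `8`, two linear functionals have a common zero on the eigenspace of `P`. -/
theorem exists_fixed_ker [FiniteDimensional ℝ V] (h : HermitianPair g I P)
    (hdim : 8 ≤ Module.finrank ℝ V) (a b : V →ₗ[ℝ] ℝ) :
    ∃ x, P x = x ∧ x ≠ 0 ∧ a x = 0 ∧ b x = 0 := by
  let E : Submodule ℝ V := LinearMap.ker (P - 1)
  have hE : ∀ x, x ∈ E ↔ P x = x := fun x => by simp [E, LinearMap.mem_ker, sub_eq_zero]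
  -- `V = E + I E` gives `dim V ≤ 2 dim E`. Four exceeds the two dimensions needed to defeat two
  -- functionals; this is where `n ≥ 2` enters.
  have hE4 : 4 ≤ Module.finrank ℝ E := by
    have hsup : E ⊔ E.map I = ⊤ := by
      refine eq_top_iff.2 fun x _ => ?_
      obtain ⟨u, v, hu, hv, rfl⟩ := h.exists_split x
      exact Submodule.add_mem_sup ((hE u).2 hu) (Submodule.mem_map_of_mem ((hE v).2 hv))
    have h1 := Submodule.finrank_add_le_finrank_add_finrank E (E.map I)
    rw [hsup, finrank_top] at h1
    have h2 := Submodule.finrank_map_le I E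
    omega
  let f : E →ₗ[ℝ] ℝ × ℝ := (a.prod b).comp E.subtype
  have hf : ¬ Function.Injective f := fun hi => by
    have := LinearMap.finrank_le_finrank_of_injective hi
    simp at this
    omega
  obtain ⟨x, hx, hx0⟩ := (Submodule.ne_bot_iff _).1 (mt LinearMap.ker_eq_bot.1 hf)
  have hx' : f x = 0 := hx
  simp [f] at hx'
  exact ⟨x, (hE x).1 x.2, fun h => hx0 (Subtype.ext h), hx'.1, hx'.2⟩

theorem exists_fixed_ne_zero [FiniteDimensional ℝ V] (h : HermitianPair g I P)
    (hdim : 8 ≤ Module.finrank ℝ V) : ∃ x, P x = x ∧ x ≠ 0 := by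
  obtain ⟨x, hx, hx0, -⟩ := h.exists_fixed_ker hdim 0 0
  exact ⟨x, hx, hx0⟩

end HermitianPair

/-- Pair symmetry of curvature tensors with skew values. -/
theorem pair_symm {R : Curv V} (hg : ∀ x y, g x y = g y x) (h0 : ∀ x, R x x = 0)
    (hskew : ∀ x y z w, g (R x y z) w = -g z (R x y w))
    (hB : ∀ x y z, R x y z + R y z x + R z x y = 0) (x y z w : V) :
    g (R x y z) w = g (R z w x) y := by
  have h0' : ∀ x y, R y x = -R x y := fun x y => by
    have := h0 (x + y)
    simp only [map_add, LinearMap.add_apply, h0, zero_add, add_zero] at this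
    exact eq_neg_of_add_eq_zero_left this
  have B : ∀ x y z w, g (R x y z) w + g (R y z x) w + g (R z x y) w = 0 := fun x y z w => by
    rw [← LinearMap.add_apply, ← LinearMap.add_apply, ← map_add, ← map_add, hB]; simp
  have s1 : ∀ x y z w, g (R y x z) w = -g (R x y z) w := fun x y z w => by
    rw [h0' x y]; simp
  have s2 : ∀ x y z w, g (R x y z) w = -g (R x y w) z := fun x y z w => by
    rw [hskew, hg]
  -- The octahedron argument: the four cyclic Bianchi identities combine to the pair symmetry once
  -- both skew-symmetries are used.
  have b1 := B x y z w
  have b2 := B y z w x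
  have b3 := B z w x y
  have b4 := B w x y z
  linarith [s1 x y z w, s2 x y z w, s1 y z x w, s2 y z x w, s1 z x y w, s2 z x y w, s2 x z y w,
    s1 y z w x, s2 y z w x, s1 z w y x, s2 z w y x, s1 w y z x, s2 w y z x,
    s1 z w x y, s2 z w x y, s1 w x z y, s2 w x z y, s1 x z w y, s2 x z w y,
    s1 w x y z, s2 w x y z, s1 x y w z, s2 x y w z, s1 y w x z, s2 y w x z]

end HermitianPair

/-! ### The `sp(1, ℝ)`-part of a curvature tensor -/

section HermitianPair

variable {V : Type*} [AddCommGroup V] [Module ℝ V]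
variable {g : LinearMap.BilinForm ℝ V} {I P S : Module.End ℝ V} {R : Curv V}

/-- The elements `A ∈ sp(n, ℝ) ⊕ sp(1, ℝ)` which kill the eigenspace of `P`. -/
theorem HermitianPair.eq_of_forall_fixed (h : HermitianPair g I P) (hS : IsSymplectic g I P S)
    {a b d : ℝ} {x₀ y₀ : V} (hx₀ : P x₀ = x₀) (h1 : g (I x₀) y₀ = 1)
    (hz : ∀ z, P z = z → S z + a • I z + b • P z + d • I (P z) = 0) :
    S = 0 ∧ b = 0 ∧ a + d = 0 := by
  -- For `z` in `E` the hypothesis has the `E`-component `S z + b z` and the `I E`-component `(a +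
  -- d) I z`; applying `P` separates them.
  have hodd : ∀ z, P z = z → (a + d) • I z = 0 ∧ S z = -b • z := fun z hPz => by
    have e1 := hz z hPz
    have e2 := congrArg P e1
    simp only [map_add, map_smul, h.P_I, ← hS.comm_P, hPz, map_zero, smul_neg] at e1 e2
    have e3 : (2 : ℝ) • ((a + d) • I z) = 0 := by
      rw [← sub_self (0 : V)]
      nth_rewrite 1 [← e1]
      rw [← e2]
      module
    have e4 : (a + d) • I z = 0 := (smul_eq_zero.1 e3).resolve_left two_ne_zero
    refine ⟨e4, ?_⟩
    have e5 : S z = (S z + a • I z + b • z + d • I z) - b • z - (a + d) • I z := by module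
    rw [e5, e1, e4]; module
  have had : a + d = 0 := by
    have h2 := congrArg (fun v => g v y₀) (hodd x₀ hx₀).1
    simpa [h1] using h2
  have hSb : ∀ z, S z = -b • z := fun z => by
    obtain ⟨u, v, hu, hv, rfl⟩ := h.exists_split z
    rw [map_add, hS.comm_I, (hodd u hu).2, (hodd v hv).2, map_smul, smul_add]
  have hb : b = 0 := by
    have h2 := hS.skew (I x₀) y₀
    rw [hSb, hSb] at h2
    simp [h1] at h2
    linarith
  exact ⟨LinearMap.ext fun z => by simp [hSb z, hb], hb, had⟩

/-- The restriction of the `sp(1, ℝ)`-part of a curvature tensor of type `sp(n, ℝ) ⊕ sp(1, ℝ)` to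
the null direction defined by `P`. -/
theorem HermitianPair.exists_null_coefficient [FiniteDimensional ℝ V] (h : HermitianPair g I P)
    (hdim : 8 ≤ Module.finrank ℝ V) (h0 : ∀ x, R x x = 0)
    (hskew : ∀ x y z w, g (R x y z) w = -g z (R x y w))
    (hB : ∀ x y z, R x y z + R y z x + R z x y = 0)
    (hdec : ∀ x y, ∃ (S : Module.End ℝ V) (a b d : ℝ), IsSymplectic g I P S ∧
      R x y = S + a • I + b • P + d • (I * P)) :
    ∃ c : ℝ, ∀ (z w : V) (S : Module.End ℝ V) (a b d : ℝ), IsSymplectic g I P S →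
      R z w = S + a • I + b • P + d • (I * P) → a + d = c * g (I z - I (P z)) w := by
  obtain ⟨x₀, hx₀, hx₀0⟩ := h.exists_fixed_ne_zero hdim
  obtain ⟨y₀, hy₀, h1⟩ := h.exists_form_eq_one hx₀ hx₀0
  -- After pair symmetry, `S x` and `b x` lie in the isotropic space `E` and pair to zero with `y`;
  -- only `(a + d) I x` survives.
  have key : ∀ x y, P x = x → P y = y → ∀ (z w : V) (S : Module.End ℝ V) (a b d : ℝ),
      IsSymplectic g I P S → R z w = S + a • I + b • P + d • (I * P) →
      g (R x y z) w = (a + d) * g (I x) y := by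
    intro x y hx hy z w S a b d hS hR
    rw [pair_symm h.symm h0 hskew hB, hR]
    have : g (S x) y = 0 := h.isotropic (by rw [← hS.comm_P, hx]) hy
    simp [hx, this, h.isotropic hx hy]
    ring
  have hC : ∀ x y, P x = x → P y = y → ∀ z, R x y z = g (I x) y • R x₀ y₀ z := by
    intro x y hx hy z
    rw [← sub_eq_zero]
    refine h.eq_zero _ fun w => ?_
    obtain ⟨S, a, b, d, hS, hR⟩ := hdec z w
    have e1 := key x y hx hy z w S a b d hS hR
    have e2 := key x₀ y₀ hx₀ hy₀ z w S a b d hS hR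
    simp only [map_sub, map_smul, LinearMap.sub_apply, LinearMap.smul_apply, e1, e2, h1,
      smul_eq_mul]
    ring
  have hC0 : ∀ z, P z = z → R x₀ y₀ z = 0 := by
    intro z hz
    refine h.eq_zero _ fun u => ?_
    -- With `C = R x₀ y₀`, Bianchi on `E` reads `ω(x,y) C z + ω(y,z) C x + ω(z,x) C y = 0`. Choosing
    -- `x` with `g u (C x) = 0` and `ω(z,x) = 0`, and `y` with `ω(x,y) = 1`, leaves `g u (C z) = 0`.
    obtain ⟨x, hx, hx0, hxa, hxb⟩ := h.exists_fixed_ker hdim ((g u).comp (R x₀ y₀)) (g (I z))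
    obtain ⟨y, hy, hxy⟩ := h.exists_form_eq_one hx hx0
    have hb := congrArg (g u) (hB x y z)
    rw [hC x y hx hy, hC y z hy hz, hC z x hz hx, hxy, hxb] at hb
    simp only [LinearMap.comp_apply] at hxa
    simp [hxa] at hb
    rw [h.symm, hb]
  obtain ⟨S, a, b, d, hS, hR⟩ := hdec x₀ y₀
  obtain ⟨rfl, rfl, had⟩ := h.eq_of_forall_fixed hS (a := a) (b := b) (d := d) hx₀ h1 fun z hz => by
    have := hC0 z hz
    rw [hR] at this
    simpa using this
  refine ⟨a, fun z w S' a' b' d' hS' hR' => ?_⟩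
  have := key x₀ y₀ hx₀ hy₀ z w S' a' b' d' hS' hR'
  rw [h1, mul_one] at this
  rw [← this, hR, eq_neg_of_add_eq_zero_right had]
  simp
  ring

/-- The `sp(1, ℝ)`-part of a curvature tensor of type `sp(n, ℝ) ⊕ sp(1, ℝ)` is determined by one
constant. -/
theorem HermitianPair.exists_coefficient [FiniteDimensional ℝ V] (h : HermitianPair g I P)
    (hdim : 8 ≤ Module.finrank ℝ V) (h0 : ∀ x, R x x = 0)
    (hskew : ∀ x y z w, g (R x y z) w = -g z (R x y w))
    (hB : ∀ x y z, R x y z + R y z x + R z x y = 0)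
    (hdec : ∀ x y, ∃ (S : Module.End ℝ V) (a b d : ℝ), IsSymplectic g I P S ∧
      R x y = S + a • I + b • P + d • (I * P)) :
    ∃ c : ℝ, ∀ z w, IsSymplectic g I P
      (R z w - c • (g (I z) w • I - g (P z) w • P - g (I (P z)) w • (I * P))) := by
  have hIT : I * (I * P) = -P := LinearMap.ext fun x => by simp [h.I_I]
  -- The pairs with `±P` and `±I * P` span the same algebra; rewriting `a, b, d` for each of them
  -- gives four null directions, which together see all three coefficients.
  obtain ⟨c₁, hc₁⟩ := h.exists_null_coefficient hdim h0 hskew hB hdec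
  obtain ⟨c₂, hc₂⟩ := h.neg.exists_null_coefficient hdim h0 hskew hB fun x y => by
    obtain ⟨S, a, b, d, hS, hR⟩ := hdec x y
    exact ⟨S, a, -b, -d, hS.of_neg, by rw [hR]; simp⟩
  obtain ⟨c₃, hc₃⟩ := h.mul.exists_null_coefficient hdim h0 hskew hB fun x y => by
    obtain ⟨S, a, b, d, hS, hR⟩ := hdec x y
    exact ⟨S, a, d, -b, hS.mul, by rw [hR, hIT]; module⟩
  obtain ⟨c₄, hc₄⟩ := h.mul.neg.exists_null_coefficient hdim h0 hskew hB fun x y => by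
    obtain ⟨S, a, b, d, hS, hR⟩ := hdec x y
    exact ⟨S, a, -d, b, hS.mul.of_neg, by rw [hR, mul_neg, hIT]; module⟩
  have main : ∀ (z w : V) (S : Module.End ℝ V) (a b d : ℝ), IsSymplectic g I P S →
      R z w = S + a • I + b • P + d • (I * P) →
      a + d = c₁ * (g (I z) w - g (I (P z)) w) ∧ a - d = c₂ * (g (I z) w + g (I (P z)) w) ∧
      a - b = c₃ * (g (I z) w + g (P z) w) ∧ a + b = c₄ * (g (I z) w - g (P z) w) := by
    intro z w S a b d hS hR
    have e1 := hc₁ z w S a b d hS hR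
    have e2 := hc₂ z w S a (-b) (-d) hS.of_neg (by rw [hR]; simp)
    have e3 := hc₃ z w S a d (-b) hS.mul (by rw [hR, hIT]; module)
    have e4 := hc₄ z w S a (-d) b hS.mul.of_neg (by rw [hR, mul_neg, hIT]; module)
    simp [h.I_I] at e1 e2 e3 e4
    refine ⟨?_, ?_, ?_, ?_⟩ <;> linarith
  obtain ⟨x₀, hx₀, hx₀0⟩ := h.exists_fixed_ne_zero hdim
  obtain ⟨y₀, hy₀, h1⟩ := h.exists_form_eq_one hx₀ hx₀0
  -- Both `(a + d) + (a - d)` and `(a - b) + (a + b)` equal `2a`. At `(x₀, y₀)`, `(I x₀, I y₀)` and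
  -- `(x₀, I y₀)` this gives `2c₂ = c₃ + c₄`, `2c₁ = c₃ + c₄` and `c₃ = c₄`.
  have hc21 : c₁ = c₄ ∧ c₂ = c₄ ∧ c₃ = c₄ := by
    obtain ⟨S, a, b, d, hS, hR⟩ := hdec x₀ y₀
    obtain ⟨S₂, a₂, b₂, d₂, hS₂, hR₂⟩ := hdec x₀ (I y₀)
    obtain ⟨S₃, a₃, b₃, d₃, hS₃, hR₃⟩ := hdec (I x₀) (I y₀)
    have m1 := main _ _ _ _ _ _ hS hR
    have m2 := main _ _ _ _ _ _ hS₂ hR₂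
    have m3 := main _ _ _ _ _ _ hS₃ hR₃
    have e1 : g x₀ (I y₀) = -1 := by linarith [h.skew_I x₀ y₀]
    have e2 := h.isotropic hx₀ hy₀
    have e3 := h.isotropic_I hx₀ hy₀
    simp [h.I_I, h.P_I, hx₀, h1, e1, e2, e3] at m1 m2 m3
    refine ⟨?_, ?_, ?_⟩ <;> linarith
  obtain ⟨rfl, rfl, rfl⟩ := hc21
  refine ⟨c₃, fun z w => ?_⟩
  obtain ⟨S, a, b, d, hS, hR⟩ := hdec z w
  obtain ⟨e1, e2, e3, e4⟩ := main z w S a b d hS hR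
  have ha : a = c₃ * g (I z) w := by linarith
  have hb : b = -(c₃ * g (P z) w) := by linarith
  have hd : d = -(c₃ * g (I (P z)) w) := by linarith
  have : R z w - c₃ • (g (I z) w • I - g (P z) w • P - g (I (P z)) w • (I * P)) = S := by
    rw [hR, ha, hb, hd]; module
  rwa [this]

end HermitianPair

/-! ### The splitting of `sp(G)` and the projective curvature tensor -/

section Structures

variable {V : Type*} [AddCommGroup V] [Module ℝ V]
variable {g : LinearMap.BilinForm ℝ V} {G : LieSubalgebra ℝ (Module.End ℝ V)}
  {J : Fin 3 → Module.End ℝ V}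

theorem IsParaHypercomplex.J_two (h : IsParaHypercomplex J) : J 2 = J 0 * J 1 := by
  have := h.mul_cyclic 2
  simpa [eps] using this.symm

theorem Corresponds.mem_iff (hJ : Corresponds G J) (A : Module.End ℝ V) :
    A ∈ G ↔ ∃ a b d : ℝ, A = a • J 0 + b • J 1 + d • (J 0 * J 1) := by
  rw [← LieSubalgebra.mem_toSubmodule, ← hJ.span_eq, Submodule.mem_span_range_iff_exists_fun,
    ← hJ.isParaHypercomplex.J_two]
  constructor
  · rintro ⟨c, rfl⟩
    exact ⟨c 0, c 1, c 2, Fin.sum_univ_three _⟩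
  · rintro ⟨a, b, d, rfl⟩
    exact ⟨![a, b, d], by simp [Fin.sum_univ_three]⟩

theorem Corresponds.J_mem (hJ : Corresponds G J) (α : Fin 3) : J α ∈ G := by
  rw [← LieSubalgebra.mem_toSubmodule, ← hJ.span_eq]
  exact Submodule.subset_span ⟨α, rfl⟩

theorem IsHermitianParaQuaternionic.skew (hG : IsHermitianParaQuaternionic g G)
    {A : Module.End ℝ V} (hA : A ∈ G) (x y : V) : g (A x) y = -g x (A y) := by
  obtain ⟨K, hK, hKg⟩ := hG
  rw [← LieSubalgebra.mem_toSubmodule, ← hK.span_eq,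
    Submodule.mem_span_range_iff_exists_fun] at hA
  obtain ⟨c, rfl⟩ := hA
  simp [Fin.sum_univ_three, hKg 0 x y, hKg 1 x y, hKg 2 x y]
  ring

theorem Corresponds.hermitianPair (hJ : Corresponds G J) (hG : IsHermitianParaQuaternionic g G)
    (hsymm : g.IsSymm) (hnondeg : g.Nondegenerate) : HermitianPair g (J 0) (J 1) := by
  have h2 := hJ.isParaHypercomplex.J_two
  have hII : ∀ x, J 0 (J 0 x) = -x := fun x => by
    simpa [eps] using LinearMap.congr_fun (hJ.isParaHypercomplex.mul_self 0) x
  have h1 : ∀ x, J 0 (J 1 (J 0 x)) = J 1 x := fun x => by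
    simpa [eps, h2] using LinearMap.congr_fun (hJ.isParaHypercomplex.mul_cyclic 1) x
  refine ⟨hsymm.eq, hnondeg.1, hII, fun x => ?_, fun x => ?_, hG.skew (hJ.J_mem 0),
    hG.skew (hJ.J_mem 1)⟩
  · simpa [eps] using LinearMap.congr_fun (hJ.isParaHypercomplex.mul_self 1) x
  · rw [← h1 x, hII, neg_neg]

theorem Corresponds.mem_spH_iff (hJ : Corresponds G J) (S : Module.End ℝ V) :
    S ∈ spH g G J ↔ IsSymplectic g (J 0) (J 1) S := by
  have h2 := hJ.isParaHypercomplex.J_two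
  constructor
  · rintro ⟨h1, h3⟩
    refine ⟨fun x => ?_, fun x => ?_, ((mem_spG g G S).1 h3).2⟩
    · exact sub_eq_zero.1 (LinearMap.congr_fun (h1 0) x)
    · exact sub_eq_zero.1 (LinearMap.congr_fun (h1 1) x)
  · intro h
    have h0 : ⁅S, J 0⁆ = 0 := LinearMap.ext fun x => sub_eq_zero.2 (h.comm_I x)
    have h1 : ⁅S, J 1⁆ = 0 := LinearMap.ext fun x => sub_eq_zero.2 (h.comm_P x)
    have h3 : ⁅S, J 0 * J 1⁆ = 0 := LinearMap.ext fun x => by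
      simp [Ring.lie_def, h.comm_I, h.comm_P]
    refine ⟨fun α => ?_, (mem_spG g G S).2 ⟨fun A hA => ?_, h.skew⟩⟩
    · fin_cases α
      exacts [h0, h1, h2 ▸ h3]
    · obtain ⟨a, b, d, rfl⟩ := (hJ.mem_iff A).1 hA
      rw [lie_add, lie_add, lie_smul, lie_smul, lie_smul, h0, h1, h3]
      simp

theorem le_spG (hG : IsHermitianParaQuaternionic g G) {A : Module.End ℝ V} (hA : A ∈ G) :
    A ∈ spG g G :=
  (mem_spG g G A).2 ⟨fun _ hB => G.lie_mem hA hB, hG.skew hA⟩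

/-- Averaging a skew endomorphism over the para-quaternionic units. -/
theorem HermitianPair.isSymplectic_average {I P : Module.End ℝ V} (h : HermitianPair g I P)
    {A : Module.End ℝ V} (hA : ∀ x y, g (A x) y = -g x (A y)) :
    IsSymplectic g I P ((1 / 4 : ℝ) • (A - I * A * I + P * A * P + I * P * A * (I * P))) := by
  refine ⟨fun x => ?_, fun x => ?_, fun x y => ?_⟩
  · simp [h.I_I, h.P_I]
    module
  · simp [h.P_I, h.P_P]
    module
  · simp [h.skew_I, h.skew_P, hA, h.P_I]
    ring

/-- The decomposition `sp(G) = sp(H) ⊕ G`. -/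
theorem Corresponds.exists_decomposition (hJ : Corresponds G J)
    (h : HermitianPair g (J 0) (J 1)) {x₀ y₀ : V} (hne : g x₀ y₀ ≠ 0)
    {A : Module.End ℝ V} (hA : A ∈ spG g G) :
    ∃ (S : Module.End ℝ V) (a b d : ℝ), IsSymplectic g (J 0) (J 1) S ∧
      A = S + a • J 0 + b • J 1 + d • (J 0 * J 1) := by
  obtain ⟨hA1, hA2⟩ := (mem_spG g G A).1 hA
  obtain ⟨a₁, b₁, d₁, e1⟩ := (hJ.mem_iff _).1 (hA1 _ (hJ.J_mem 0))
  obtain ⟨a₂, b₂, d₂, e2⟩ := (hJ.mem_iff _).1 (hA1 _ (hJ.J_mem 1))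
  set I := J 0
  set P := J 1
  have f1 : ∀ x, A (I x) = I (A x) + (a₁ • I x + b₁ • P x + d₁ • I (P x)) := fun x =>
    sub_eq_iff_eq_add'.1 (LinearMap.congr_fun e1 x)
  have f2 : ∀ x, A (P x) = P (A x) + (a₂ • I x + b₂ • P x + d₂ • I (P x)) := fun x =>
    sub_eq_iff_eq_add'.1 (LinearMap.congr_fun e2 x)
  have hS := h.isSymplectic_average hA2
  set S := (1 / 4 : ℝ) • (A - I * A * I + P * A * P + I * P * A * (I * P)) with hSdef
  have hAS : ∃ s a b d : ℝ, ∀ x, A x = S x + (s • x + a • I x + b • P x + d • I (P x)) := by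
    -- Moving `A` past the units in the average with `f1` and `f2` makes `A - S` a para-quaternion;
    -- its coefficients are read off from the two brackets.
    refine ⟨-(1 / 2) * (a₁ + b₂), (1 / 2) * d₂, -(1 / 2) * d₁, (1 / 2) * a₂, fun x => ?_⟩
    simp only [hSdef, LinearMap.smul_apply, LinearMap.add_apply, LinearMap.sub_apply,
      Module.End.mul_apply, f1, f2, map_add, map_smul, h.I_I, h.P_P, h.P_I, map_neg]
    module
  obtain ⟨s, a, b, d, hx⟩ := hAS
  -- Every other term is `g`-skew, whereas the scalar `s` is `g`-symmetric.
  have hs : s = 0 := by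
    have h1 := hA2 x₀ y₀
    simp only [hx, map_add, map_smul, LinearMap.add_apply, LinearMap.smul_apply, smul_eq_mul,
      hS.skew, h.skew_I, h.skew_P, h.P_I, map_neg] at h1
    have h2 : s * g x₀ y₀ = 0 := by linarith
    exact (mul_eq_zero.1 h2).resolve_right hne
  exact ⟨S, a, b, d, hS, LinearMap.ext fun x => by rw [hx, hs]; simp; abel⟩

theorem mem_curvatureTensors {L : LieSubalgebra ℝ (Module.End ℝ V)} {R : Curv V} :
    R ∈ curvatureTensors L ↔ (∀ X, R X X = 0) ∧ (∀ X Y, R X Y ∈ L) ∧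
      ∀ X Y Z, R X Y Z + R Y Z X + R Z X Y = 0 :=
  Iff.rfl

theorem Corresponds.projectiveCurvature_eq (hJ : Corresponds G J) (X Y Z : V) :
    projectiveCurvature g J X Y Z = g Y Z • X - g X Z • Y
      + (g (J 0 Y) Z • J 0 X - g (J 0 X) Z • J 0 Y)
      - (g (J 1 Y) Z • J 1 X - g (J 1 X) Z • J 1 Y)
      - (g (J 0 (J 1 Y)) Z • J 0 (J 1 X) - g (J 0 (J 1 X)) Z • J 0 (J 1 Y))
      - (2 : ℝ) • (g (J 0 X) Y • J 0 Z - g (J 1 X) Y • J 1 Z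
        - g (J 0 (J 1 X)) Y • J 0 (J 1 Z)) := by
  rw [projectiveCurvature_apply, Fin.sum_univ_three, Fin.sum_univ_three,
    hJ.isParaHypercomplex.J_two]
  simp [eps]
  module

/-- Adding back the last sum of the projective tensor leaves four times the average, as in
`isSymplectic_average`, of the skew map `Z ↦ g Y Z • X - g X Z • Y`. So the `G`-part of the tensor
is that last sum. -/
theorem Corresponds.isSymplectic_projectiveCurvature_add (hJ : Corresponds G J)
    (h : HermitianPair g (J 0) (J 1)) (X Y : V) :
    IsSymplectic g (J 0) (J 1) (projectiveCurvature g J X Y + (2 : ℝ) • (g (J 0 X) Y • J 0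
      - g (J 1 X) Y • J 1 - g (J 0 (J 1 X)) Y • (J 0 * J 1))) := by
  have hI : ∀ x y, g x (J 0 y) = -g (J 0 x) y := fun x y => by rw [h.skew_I, neg_neg]
  have hP : ∀ x y, g x (J 1 y) = -g (J 1 x) y := fun x y => by rw [h.skew_P, neg_neg]
  refine ⟨fun z => ?_, fun z => ?_, fun z w => ?_⟩
  · simp [hJ.projectiveCurvature_eq, hI, h.I_I, h.P_I]
    module
  · simp [hJ.projectiveCurvature_eq, hP, h.P_P, h.P_I]
    module
  · simp only [hJ.projectiveCurvature_eq, LinearMap.add_apply, LinearMap.smul_apply,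
      LinearMap.sub_apply, Module.End.mul_apply, map_add, map_sub, map_smul, smul_eq_mul,
      h.symm z, h.form_skew_P z w, h.form_skew_I_P z w, h.form_skew z w]
    ring

theorem Corresponds.projectiveCurvature_mem (hJ : Corresponds G J)
    (hG : IsHermitianParaQuaternionic g G) (h : HermitianPair g (J 0) (J 1)) :
    projectiveCurvature g J ∈ curvatureTensors (spG g G) := by
  have hI : ∀ x y, g (J 0 y) x = -g (J 0 x) y := fun x y => h.form_skew y x
  have hP : ∀ x y, g (J 1 y) x = -g (J 1 x) y := fun x y => h.form_skew_P y x
  have hT : ∀ x y, g (J 0 (J 1 y)) x = -g (J 0 (J 1 x)) y := fun x y => h.form_skew_I_P y x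
  refine ⟨fun X => LinearMap.ext fun Z => ?_, fun X Y => ?_, fun X Y Z => ?_⟩
  · have h1 : g (J 0 X) X = 0 := h.form_self X
    have h2 : g (J 1 X) X = 0 := by linarith [hP X X]
    have h3 : g (J 0 (J 1 X)) X = 0 := by linarith [hT X X]
    simp [hJ.projectiveCurvature_eq, h1, h2, h3]
  · have e : projectiveCurvature g J X Y = (projectiveCurvature g J X Y
        + (2 : ℝ) • (g (J 0 X) Y • J 0 - g (J 1 X) Y • J 1 - g (J 0 (J 1 X)) Y • (J 0 * J 1)))
        - (2 : ℝ) • (g (J 0 X) Y • J 0 - g (J 1 X) Y • J 1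
          - g (J 0 (J 1 X)) Y • (J 0 * J 1)) := by abel
    rw [e]
    refine (spG g G).sub_mem
      ((hJ.mem_spH_iff _).2 (hJ.isSymplectic_projectiveCurvature_add h X Y)).2
      (le_spG hG ((hJ.mem_iff _).2 ⟨2 * g (J 0 X) Y, -2 * g (J 1 X) Y,
        -2 * g (J 0 (J 1 X)) Y, ?_⟩))
    module
  · simp only [hJ.projectiveCurvature_eq]
    rw [h.symm Y X, h.symm Z Y, h.symm Z X, hI X Y, hI Y Z, hI X Z, hP X Y, hP Y Z, hP X Z,
      hT X Y, hT Y Z, hT X Z]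
    module

/-- The tensor is built from `g` and `∑ ε_α J_α ⊗ J_α`, both fixed by `sp(G)`. The identity is
linear in `A`, so it is checked on `S` and on each unit. -/
theorem Corresponds.projectiveCurvature_invariant (hJ : Corresponds G J)
    (h : HermitianPair g (J 0) (J 1)) {S : Module.End ℝ V} (hS : IsSymplectic g (J 0) (J 1) S)
    (a b d : ℝ) {A : Module.End ℝ V} (hA : A = S + a • J 0 + b • J 1 + d • (J 0 * J 1))
    (X Y Z : V) :
    A (projectiveCurvature g J X Y Z) - projectiveCurvature g J (A X) Y Z
      - projectiveCurvature g J X (A Y) Z - projectiveCurvature g J X Y (A Z) = 0 := by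
  have hI : ∀ x y, g x (J 0 y) = -g (J 0 x) y := fun x y => by rw [h.skew_I, neg_neg]
  have hP : ∀ x y, g x (J 1 y) = -g (J 1 x) y := fun x y => by rw [h.skew_P, neg_neg]
  have hSS : ∀ x y, g x (S y) = -g (S x) y := fun x y => by rw [hS.skew, neg_neg]
  have c0 : S (projectiveCurvature g J X Y Z) - projectiveCurvature g J (S X) Y Z
      - projectiveCurvature g J X (S Y) Z - projectiveCurvature g J X Y (S Z) = 0 := by
    simp only [hJ.projectiveCurvature_eq, hSS, ← hS.comm_I, ← hS.comm_P, map_add, map_sub,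
      map_smul]
    module
  have c1 : J 0 (projectiveCurvature g J X Y Z) - projectiveCurvature g J (J 0 X) Y Z
      - projectiveCurvature g J X (J 0 Y) Z - projectiveCurvature g J X Y (J 0 Z) = 0 := by
    simp only [hJ.projectiveCurvature_eq, hI, h.I_I, h.P_I, map_add, map_sub,
      map_smul, map_neg, LinearMap.neg_apply]
    module
  have c2 : J 1 (projectiveCurvature g J X Y Z) - projectiveCurvature g J (J 1 X) Y Z
      - projectiveCurvature g J X (J 1 Y) Z - projectiveCurvature g J X Y (J 1 Z) = 0 := by
    simp only [hJ.projectiveCurvature_eq, hP, h.P_P, h.P_I, map_add, map_sub,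
      map_smul, map_neg, LinearMap.neg_apply]
    module
  have c3 : J 0 (J 1 (projectiveCurvature g J X Y Z))
      - projectiveCurvature g J (J 0 (J 1 X)) Y Z
      - projectiveCurvature g J X (J 0 (J 1 Y)) Z
      - projectiveCurvature g J X Y (J 0 (J 1 Z)) = 0 := by
    simp only [hJ.projectiveCurvature_eq, hP, hI, h.P_P, h.P_I, h.I_I, map_add, map_sub,
      map_smul, map_neg, LinearMap.neg_apply, neg_neg]
    module
  rw [hA]
  simp only [LinearMap.add_apply, LinearMap.smul_apply, map_add, map_smul, Module.End.mul_apply]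
  linear_combination (norm := module) c0 + a • c1 + b • c2 + d • c3

end Structures

/-! ### Ricci tensors -/

section Ricci

variable {V : Type*} [AddCommGroup V] [Module ℝ V]
variable {g : LinearMap.BilinForm ℝ V} {I P : Module.End ℝ V} {R : Curv V}

/-- The duality defined by `g` conjugates `S` to minus its transpose. -/
theorem trace_eq_zero_of_skew [FiniteDimensional ℝ V] (hg : g.Nondegenerate)
    {S : Module.End ℝ V} (hS : ∀ x y, g (S x) y = -g x (S y)) : LinearMap.trace ℝ V S = 0 := by
  have h1 : (g.toDual hg).conj S = -Module.Dual.transpose (R := ℝ) S := by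
    refine LinearMap.ext fun f => LinearMap.ext fun y => ?_
    obtain ⟨x, rfl⟩ := (g.toDual hg).surjective f
    simp only [LinearEquiv.conj_apply, LinearMap.comp_apply, LinearEquiv.coe_coe,
      LinearEquiv.symm_apply_apply]
    exact hS x y
  have h2 := LinearMap.trace_conj' S (g.toDual hg)
  have h3 := (LinearMap.trace ℝ (Module.Dual ℝ V)).map_neg (Module.Dual.transpose (R := ℝ) S)
  rw [LinearMap.trace_transpose'] at h3
  rw [h1, h3] at h2
  linarith

/-- Conjugation by the involution `P` changes the sign of `A * I` but not its trace. -/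
theorem HermitianPair.trace_mul_I (h : HermitianPair g I P) {A : Module.End ℝ V}
    (hP : ∀ x, A (P x) = P (A x)) : LinearMap.trace ℝ V (A * I) = 0 := by
  have h1 := LinearMap.trace_mul_comm ℝ P (P * (A * I))
  have h2 : P * (P * (A * I)) = A * I := LinearMap.ext fun x => by simp [h.P_P]
  have h3 : P * (A * I) * P = -(A * I) := LinearMap.ext fun x => by
    simp [← hP, h.P_P, h.P_I]
  rw [h2, h3, map_neg] at h1
  linarith

theorem HermitianPair.trace_mul_P (h : HermitianPair g I P) {A : Module.End ℝ V}
    (hI : ∀ x, A (I x) = I (A x)) : LinearMap.trace ℝ V (A * P) = 0 := by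
  have h1 := LinearMap.trace_mul_comm ℝ I (I * (A * P))
  have h2 : I * (I * (A * P)) = -(A * P) := LinearMap.ext fun x => by simp [h.I_I]
  have h3 : I * (A * P) * I = A * P := LinearMap.ext fun x => by
    simp [← hI, h.I_I, h.P_I]
  rw [h2, h3, map_neg] at h1
  linarith

theorem ricci_apply (R : Curv V) (Y Z : V) :
    ricci R Y Z = LinearMap.trace ℝ V ((R.flip Y).flip Z) := rfl

theorem scalarCurvature_of_ricci_eq [FiniteDimensional ℝ V] (hg : g.Nondegenerate) {μ : ℝ}
    (h : ricci R = μ • g) : scalarCurvature g hg R = μ * Module.finrank ℝ V := by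
  have h1 : (g.toDual hg).symm.toLinearMap ∘ₗ (μ • g) = μ • LinearMap.id := by
    refine LinearMap.ext fun x => ?_
    have : (g.toDual hg).symm (g x) = x := (LinearEquiv.symm_apply_eq _).2 rfl
    simp [this]
  rw [scalarCurvature, h, h1]
  simp

theorem Corresponds.ricci_projectiveCurvature [FiniteDimensional ℝ V]
    {G : LieSubalgebra ℝ (Module.End ℝ V)} {J : Fin 3 → Module.End ℝ V} (hJ : Corresponds G J)
    (h : HermitianPair g (J 0) (J 1)) :
    ricci (projectiveCurvature g J) = (Module.finrank ℝ V + 8 : ℝ) • g := by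
  refine LinearMap.ext fun Y => LinearMap.ext fun Z => ?_
  have e : ((projectiveCurvature g J).flip Y).flip Z = g Y Z • (1 : Module.End ℝ V)
      - (g Z).smulRight Y
      + (g (J 0 Y) Z • J 0 + (g (J 0 Z)).smulRight (J 0 Y))
      - (g (J 1 Y) Z • J 1 + (g (J 1 Z)).smulRight (J 1 Y))
      - (g (J 0 (J 1 Y)) Z • (J 0 * J 1) + (g (J 0 (J 1 Z))).smulRight (J 0 (J 1 Y)))
      + (2 : ℝ) • ((g (J 0 Y)).smulRight (J 0 Z) - (g (J 1 Y)).smulRight (J 1 Z)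
        - (g (J 0 (J 1 Y))).smulRight (J 0 (J 1 Z))) := by
    refine LinearMap.ext fun X => ?_
    simp [hJ.projectiveCurvature_eq, h.symm X Z, h.form_skew X, h.form_skew_P X,
      h.form_skew_I_P X]
    module
  have t0 : LinearMap.trace ℝ V (J 0) = 0 := by
    simpa using h.trace_mul_I (A := 1) fun _ => rfl
  have t1 : LinearMap.trace ℝ V (J 1) = 0 := by
    simpa using h.trace_mul_P (A := 1) fun _ => rfl
  have t2 : LinearMap.trace ℝ V (J 0 * J 1) = 0 := h.trace_mul_P fun _ => rfl
  -- The traces add up to `dim V - 1 + 3 + 6`: each of the three units contributes `1` from its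
  -- rank-one term in the first group and `2` from the last group.
  rw [ricci_apply, e]
  simp only [map_add, map_sub, map_smul, t0, t1, t2, LinearMap.trace_smulRight,
    LinearMap.trace_one, smul_eq_mul, LinearMap.smul_apply]
  simp only [h.skew_I, h.skew_P, h.I_I, h.P_P, h.P_I, h.symm Z Y, map_neg]
  ring

/-- The curvature tensors of type `sp(n, ℝ)`. -/
structure IsSymplecticCurvature (g : LinearMap.BilinForm ℝ V) (I P : Module.End ℝ V)
    (R : Curv V) : Prop where
  self : ∀ x, R x x = 0
  symplectic : ∀ x y, IsSymplectic g I P (R x y)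
  bianchi : ∀ x y z, R x y z + R y z x + R z x y = 0

theorem Corresponds.mem_curvatureTensors_spH_iff {G : LieSubalgebra ℝ (Module.End ℝ V)}
    {J : Fin 3 → Module.End ℝ V} (hJ : Corresponds G J) :
    R ∈ curvatureTensors (spH g G J) ↔ IsSymplecticCurvature g (J 0) (J 1) R := by
  rw [mem_curvatureTensors]
  simp only [hJ.mem_spH_iff]
  exact ⟨fun h => ⟨h.1, h.2.1, h.2.2⟩, fun h => ⟨h.1, h.2, h.3⟩⟩

namespace IsSymplecticCurvature

theorem swap (hR : IsSymplecticCurvature g I P R) (x y : V) : R y x = -R x y := by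
  have := hR.self (x + y)
  simp only [map_add, LinearMap.add_apply, hR.self, zero_add, add_zero] at this
  exact eq_neg_of_add_eq_zero_left this

theorem pair (hR : IsSymplecticCurvature g I P R) (h : HermitianPair g I P) (x y z w : V) :
    g (R x y z) w = g (R z w x) y :=
  pair_symm h.symm hR.self (fun x y => (hR.symplectic x y).skew) hR.bianchi x y z w

/-- Pair symmetry turns commutation of the values with `I` into a symmetry in the arguments. -/
theorem I_left (hR : IsSymplecticCurvature g I P R) (h : HermitianPair g I P) (x y : V) :
    R (I x) y = -R x (I y) := by
  refine LinearMap.ext fun z => sub_eq_zero.1 (h.eq_zero _ fun w => ?_)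
  rw [map_sub, LinearMap.sub_apply, LinearMap.neg_apply, map_neg, LinearMap.neg_apply,
    hR.pair h, hR.pair h x, (hR.symplectic z w).comm_I, h.skew_I]
  ring

theorem P_left (hR : IsSymplecticCurvature g I P R) (h : HermitianPair g I P) (x y : V) :
    R (P x) y = -R x (P y) := by
  refine LinearMap.ext fun z => sub_eq_zero.1 (h.eq_zero _ fun w => ?_)
  rw [map_sub, LinearMap.sub_apply, LinearMap.neg_apply, map_neg, LinearMap.neg_apply,
    hR.pair h, hR.pair h x, (hR.symplectic z w).comm_P, h.skew_P]
  ring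

theorem fixed_fixed (hR : IsSymplecticCurvature g I P R) (h : HermitianPair g I P) {x y : V}
    (hx : P x = x) (hy : P y = y) : R x y = 0 := by
  have := hR.P_left h x y
  rw [hx, hy] at this
  have h2 : (2 : ℝ) • R x y = 0 := by rw [two_smul]; nth_rewrite 2 [this]; exact add_neg_cancel _
  exact (smul_eq_zero.1 h2).resolve_left two_ne_zero

theorem I_I (hR : IsSymplecticCurvature g I P R) (h : HermitianPair g I P) (x y : V) :
    R (I x) (I y) = R x y := by
  rw [hR.I_left h, h.I_I, map_neg, neg_neg]

theorem fixed_symm (hR : IsSymplecticCurvature g I P R) (h : HermitianPair g I P) {x y z : V}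
    (hx : P x = x) (hz : P z = z) : R x (I y) z = R z (I y) x := by
  have := hR.bianchi x (I y) z
  rw [hR.fixed_fixed h hz hx, hR.swap z (I y)] at this
  simp only [LinearMap.neg_apply, LinearMap.zero_apply, add_zero] at this
  exact add_neg_eq_zero.1 this

/-- By `I_left`, `P_left` and cyclicity of the trace, `I` and `P` are skew for the Ricci form, so it
vanishes on `E × E` and only `I E × E` needs a computation. -/
theorem ricci_eq_zero [FiniteDimensional ℝ V] (hR : IsSymplecticCurvature g I P R)
    (h : HermitianPair g I P) (hg : g.Nondegenerate) : ricci R = 0 := by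
  have hI : ∀ y z, ricci R (I y) z = -ricci R y (I z) := fun y z => by
    have e1 : (R.flip (I y)).flip z = -((R.flip y).flip z * I) := LinearMap.ext fun x => by
      simp [hR.I_left h]
    have e2 : (R.flip y).flip (I z) = I * (R.flip y).flip z := LinearMap.ext fun x => by
      simp [(hR.symplectic x y).comm_I]
    rw [ricci_apply, ricci_apply, e1, e2, map_neg, LinearMap.trace_mul_comm]
  have hP : ∀ y z, ricci R (P y) z = -ricci R y (P z) := fun y z => by
    have e1 : (R.flip (P y)).flip z = -((R.flip y).flip z * P) := LinearMap.ext fun x => by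
      simp [hR.P_left h]
    have e2 : (R.flip y).flip (P z) = P * (R.flip y).flip z := LinearMap.ext fun x => by
      simp [(hR.symplectic x y).comm_P]
    rw [ricci_apply, ricci_apply, e1, e2, map_neg, LinearMap.trace_mul_comm]
  have h0 : ∀ y z, P y = y → P z = z → ricci R y z = 0 := fun y z hy hz => by
    have := hP y z
    rw [hy, hz] at this
    linarith
  have h1 : ∀ y z, P y = y → P z = z → ricci R (I y) z = 0 := fun y z hy hz => by
    -- The map `x ↦ R x (I y) z` kills `I E` and agrees with `R z (I y)` on `E`, so it is `R z (I
    -- y)` composed with the projection `(1 + P) / 2`.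
    have e : (R.flip (I y)).flip z = (1 / 2 : ℝ) • (R z (I y) + R z (I y) * P) := by
      refine LinearMap.ext fun x => ?_
      obtain ⟨u, v, hu, hv, rfl⟩ := h.exists_split x
      simp [hR.I_I h, hR.fixed_fixed h hv hy, hu, h.P_I, hv, hR.fixed_symm h hu hz]
      module
    rw [ricci_apply, e, map_smul, map_add, h.trace_mul_P (hR.symplectic _ _).comm_I,
      trace_eq_zero_of_skew hg (hR.symplectic _ _).skew]
    simp
  refine LinearMap.ext fun y => LinearMap.ext fun z => ?_
  obtain ⟨u, v, hu, hv, rfl⟩ := h.exists_split y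
  obtain ⟨u', v', hu', hv', rfl⟩ := h.exists_split z
  have e1 : ricci R u (I v') = 0 := by linarith [hI u v', h1 u v' hu hv']
  have e2 : ricci R (I v) (I v') = 0 := by
    rw [hI, h.I_I, map_neg, h0 v v' hv hv']; simp
  simp [h0 u u' hu hu', h1 v u' hv hu', e1, e2]

end IsSymplecticCurvature

end Ricci

/-! ### Irreducibility of the curvature tensors of type `sp(n, ℝ)` -/

section Irreducibility

variable {V : Type*} [AddCommGroup V] [Module ℝ V]
variable {g : LinearMap.BilinForm ℝ V} {I P : Module.End ℝ V} {R : Curv V}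

/-- The nilpotent element of `sp(n, ℝ)` which corresponds to the square of a vector `e` in the
eigenspace of `P`. -/
def nullEnd (g : LinearMap.BilinForm ℝ V) (I : Module.End ℝ V) (e : V) : Module.End ℝ V :=
  (g (I e)).smulRight e - (g e).smulRight (I e)

theorem nullEnd_apply (e x : V) : nullEnd g I e x = g (I e) x • e - g e x • I e := rfl

/-- The curvature tensor of type `sp(n, ℝ)` which corresponds to the fourth power of a vector `e` in
the eigenspace of `P`. -/
def nullCurv (g : LinearMap.BilinForm ℝ V) (I : Module.End ℝ V) (e : V) : Curv V :=
  LinearMap.mk₂ ℝ (fun X Y => g (nullEnd g I e X) Y • nullEnd g I e)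
    (fun X X' Y => by simp [add_smul]) (fun c X Y => by simp [mul_smul])
    (fun X Y Y' => by simp [add_smul]) (fun c X Y => by simp [mul_smul])

theorem nullCurv_apply (e x y : V) :
    nullCurv g I e x y = g (nullEnd g I e x) y • nullEnd g I e := rfl

theorem HermitianPair.isSymplectic_nullEnd (h : HermitianPair g I P) {e : V} (he : P e = e) :
    IsSymplectic g I P (nullEnd g I e) := by
  have hI : ∀ x y, g x (I y) = -g (I x) y := fun x y => by rw [h.skew_I, neg_neg]
  have hP : ∀ x y, g x (P y) = -g (P x) y := fun x y => by rw [h.skew_P, neg_neg]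
  refine ⟨fun x => ?_, fun x => ?_, fun x y => ?_⟩
  · simp [nullEnd_apply, hI, h.I_I]
    abel
  · simp [nullEnd_apply, hP, h.P_I, he]
  · simp [nullEnd_apply, h.symm x]
    ring

theorem HermitianPair.nullEnd_nullEnd (h : HermitianPair g I P) {e : V} (he : P e = e) (x : V) :
    nullEnd g I e (nullEnd g I e x) = 0 := by
  simp [nullEnd_apply, h.form_self, h.isotropic he he, h.isotropic_I he he, h.symm e (I e)]

/-- With `α = g (I e)` and `β = g e`, the form `g (nullEnd g I e x) y` is `α ∧ β` and `nullEnd g I e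
z = α(z) e - β(z) I e`, so Bianchi reduces to `α ∧ β ∧ α = 0 = α ∧ β ∧ β`. -/
theorem HermitianPair.isSymplecticCurvature_nullCurv (h : HermitianPair g I P) {e : V}
    (he : P e = e) : IsSymplecticCurvature g I P (nullCurv g I e) := by
  have hS := h.isSymplectic_nullEnd he
  refine ⟨fun x => ?_, fun x y => ⟨fun z => ?_, fun z => ?_, fun z w => ?_⟩, fun x y z => ?_⟩
  · have : g (nullEnd g I e x) x = 0 := by simp [nullEnd_apply]; ring
    rw [nullCurv_apply, this, zero_smul]
  · simp [nullCurv_apply, hS.comm_I]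
  · simp [nullCurv_apply, hS.comm_P]
  · simp [nullCurv_apply, hS.skew]
  · simp [nullCurv_apply, nullEnd_apply]
    module

theorem HermitianPair.nullCurv_quartic (h : HermitianPair g I P) {e f : V} (he : P e = e)
    (hf : P f = f) : g (nullCurv g I e f (I f) f) (I f) = g (I e) f ^ 4 := by
  have : g e (I f) = -g (I e) f := by rw [h.skew_I, neg_neg]
  simp [nullCurv_apply, nullEnd_apply, h.isotropic he hf, this]
  ring

/-- The fourth power of the action of an endomorphism with square zero. -/
theorem lie_pow_four_apply (L : LieSubalgebra ℝ (Module.End ℝ V)) (A : L)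
    (hA : ∀ x, A.1 (A.1 x) = 0) (R : Curv V) (x y z : V) :
    ⁅A, ⁅A, ⁅A, ⁅A, R⁆⁆⁆⁆ x y z = -(24 : ℝ) • A.1 (R (A.1 x) (A.1 y) (A.1 z)) := by
  -- Since `A² = 0`, only terms hitting each of the four slots once survive: `4! = 24` orderings,
  -- with sign `(-1)³` from the three arguments.
  simp only [lie_curv_apply, map_sub, hA, map_zero, LinearMap.zero_apply]
  module

namespace IsSymplecticCurvature

theorem lie_nullEnd_pow_four (hR : IsSymplecticCurvature g I P R) (h : HermitianPair g I P)
    {L : LieSubalgebra ℝ (Module.End ℝ V)} {e : V} (he : P e = e) (A : L)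
    (hA : A.1 = nullEnd g I e) :
    ⁅A, ⁅A, ⁅A, ⁅A, R⁆⁆⁆⁆ = (24 * g (R e (I e) e) (I e)) • nullCurv g I e := by
  have hS := h.isSymplectic_nullEnd he
  refine LinearMap.ext fun x => LinearMap.ext fun y => LinearMap.ext fun z => ?_
  rw [lie_pow_four_apply L A (by rw [hA]; exact h.nullEnd_nullEnd he), hA]
  set B := R e (I e) with hB
  have hBS : IsSymplectic g I P B := hR.symplectic _ _
  have e1 : R (nullEnd g I e x) (nullEnd g I e y) = -g (nullEnd g I e x) y • B := by
    simp [nullEnd_apply, hR.self, hR.swap e (I e), ← hB]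
    module
  have e2 : nullEnd g I e (B e) = g (B e) (I e) • e := by
    rw [nullEnd_apply, h.isotropic he (by rw [← hBS.comm_P, he] : P (B e) = B e), h.symm (I e)]
    simp
  have e3 : nullEnd g I e (B (nullEnd g I e z)) = g (B e) (I e) • nullEnd g I e z := by
    rw [nullEnd_apply e z]
    simp only [map_sub, map_smul, hBS.comm_I, hS.comm_I, e2]
    module
  rw [e1]
  simp only [LinearMap.smul_apply, map_smul, e3, nullCurv_apply]
  module

/-- A curvature tensor of type `sp(n, ℝ)` is determined by its quartic form. -/
theorem eq_zero_of_quartic (hR : IsSymplecticCurvature g I P R) (h : HermitianPair g I P)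
    (h0 : ∀ e, P e = e → g (R e (I e) e) (I e) = 0) : R = 0 := by
  have s12 : ∀ x y z w, g (R x (I y) z) (I w) = g (R y (I x) z) (I w) := fun x y z w => by
    rw [← neg_neg (R x (I y)), ← hR.I_left h, ← hR.swap]
  have s13 : ∀ x y z w, P x = x → P z = z →
      g (R x (I y) z) (I w) = g (R z (I y) x) (I w) := fun x y z w hx hz => by
    rw [hR.fixed_symm h hx hz]
  have s34 : ∀ x y z w, g (R x (I y) z) (I w) = g (R x (I y) w) (I z) := fun x y z w => by
    rw [(hR.symplectic _ _).skew, (hR.symplectic _ _).comm_I, h.symm, h.skew_I, neg_neg]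
  -- Polarization: `s12`, `s13`, `s34` make the form totally symmetric on `E`. For its quartic `q`,
  -- `q(x + y) + q(x - y) - 2 q(x) - 2 q(y)` is twelve times the mixed term.
  have f22 : ∀ x y, P x = x → P y = y → g (R x (I x) y) (I y) = 0 := fun x y hx hy => by
    have e1 := h0 (x + y) (by rw [map_add, hx, hy])
    have e2 := h0 (x - y) (by rw [map_sub, hx, hy])
    have e3 := h0 x hx
    have e4 := h0 y hy
    simp only [map_add, map_sub, LinearMap.add_apply, LinearMap.sub_apply] at e1 e2
    linarith [s12 x y x y, s12 x y y x, s13 x x y y hx hy, s34 x y x y, s34 y x x y,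
      s13 y y x x hy hx]
  have f211 : ∀ x y z, P x = x → P y = y → P z = z → g (R x (I x) y) (I z) = 0 :=
    fun x y z hx hy hz => by
    have e1 := f22 x (y + z) hx (by rw [map_add, hy, hz])
    simp only [map_add, LinearMap.add_apply, f22 x y hx hy, f22 x z hx hz] at e1
    linarith [s34 x x y z]
  have f1 : ∀ x y z w, P x = x → P y = y → P z = z → P w = w → g (R x (I y) z) (I w) = 0 :=
    fun x y z w hx hy hz hw => by
    have e1 := f211 (x + y) z w (by rw [map_add, hx, hy]) hz hw
    simp only [map_add, LinearMap.add_apply, f211 x z w hx hz hw, f211 y z w hy hz hw] at e1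
    linarith [s12 x y z w]
  have r0 : ∀ x y z, P x = x → P y = y → P z = z → R x (I y) z = 0 := fun x y z hx hy hz => by
    refine h.eq_zero_of_fixed (by rw [← (hR.symplectic _ _).comm_P, hz]) fun w hw => ?_
    rw [h.skew_I, f1 x y z w hx hy hz hw, neg_zero]
  have r1 : ∀ x y, P x = x → P y = y → R x (I y) = 0 := fun x y hx hy => by
    refine LinearMap.ext fun z => ?_
    obtain ⟨u, v, hu, hv, rfl⟩ := h.exists_split z
    rw [map_add, (hR.symplectic _ _).comm_I, r0 x y u hx hy hu, r0 x y v hx hy hv]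
    simp
  refine LinearMap.ext fun x => LinearMap.ext fun y => ?_
  obtain ⟨u, v, hu, hv, rfl⟩ := h.exists_split x
  obtain ⟨u', v', hu', hv', rfl⟩ := h.exists_split y
  simp [hR.I_I h, hR.fixed_fixed h hu hu', hR.fixed_fixed h hv hv', r1 u v' hu hv',
    hR.swap u' (I v), r1 u' v hu' hv]

end IsSymplecticCurvature

/-- The full contraction of two curvature tensors with respect to a nondegenerate form. -/
noncomputable def contraction [FiniteDimensional ℝ V] (hg : g.Nondegenerate) : Curv V →ₗ[ℝ] Curv V →ₗ[ℝ] ℝ :=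
  let b := Module.finBasis ℝ V
  let d := g.dualBasis hg b
  LinearMap.mk₂ ℝ (fun Q R => ∑ i, ∑ j, LinearMap.trace ℝ V (Q (b i) (b j) * R (d i) (d j)))
    (fun Q Q' R => by simp [add_mul, Finset.sum_add_distrib])
    (fun c Q R => by simp [Finset.mul_sum])
    (fun Q R R' => by simp [mul_add, Finset.sum_add_distrib])
    (fun c Q R => by simp [Finset.mul_sum])

theorem sum_smul_dualBasis [FiniteDimensional ℝ V] (hg : g.Nondegenerate) (x : V) :
    ∑ i, g x (Module.finBasis ℝ V i) • g.dualBasis hg (Module.finBasis ℝ V) i = x := by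
  conv_rhs => rw [← (g.dualBasis hg (Module.finBasis ℝ V)).sum_repr x]
  simp only [LinearMap.BilinForm.dualBasis_repr_apply]

/-- Contracting with `e⁴` evaluates the quartic form at `e`: the sums over dual bases collapse to
`-2 tr (A * R e (I e))`, and that trace is twice the quartic. -/
theorem IsSymplecticCurvature.contraction_nullCurv [FiniteDimensional ℝ V]
    (hR : IsSymplecticCurvature g I P R) (h : HermitianPair g I P) (hg : g.Nondegenerate) (e : V) :
    contraction hg (nullCurv g I e) R = -4 * g (R e (I e) e) (I e) := by
  set b := Module.finBasis ℝ V with hb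
  set d := g.dualBasis hg b with hd
  set A := nullEnd g I e with hA
  have e1 : ∀ i, ∑ j, LinearMap.trace ℝ V (nullCurv g I e (b i) (b j) * R (d i) (d j)) =
      g (I e) (b i) * LinearMap.trace ℝ V (A * R (d i) e)
        - g e (b i) * LinearMap.trace ℝ V (A * R (d i) (I e)) := fun i => by
    have : ∑ j, LinearMap.trace ℝ V (nullCurv g I e (b i) (b j) * R (d i) (d j)) =
        LinearMap.trace ℝ V (A * R (d i) (∑ j, g (A (b i)) (b j) • d j)) := by
      simp [nullCurv_apply, Finset.mul_sum, ← hA]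
    rw [this, sum_smul_dualBasis hg, hA, nullEnd_apply]
    simp [mul_sub]
  have e2 : ∀ x y, ∑ i, g x (b i) * LinearMap.trace ℝ V (A * R (d i) y) =
      LinearMap.trace ℝ V (A * R x y) := fun x y => by
    have : ∑ i, g x (b i) * LinearMap.trace ℝ V (A * R (d i) y) =
        LinearMap.trace ℝ V (A * R (∑ i, g x (b i) • d i) y) := by
      simp [Finset.mul_sum]
    rw [this, sum_smul_dualBasis hg]
  have e3 : LinearMap.trace ℝ V (A * R e (I e)) = 2 * g (R e (I e) e) (I e) := by
    have hS := hR.symplectic e (I e)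
    have : A * R e (I e) = ((g (I e)).comp (R e (I e))).smulRight e
        - ((g e).comp (R e (I e))).smulRight (I e) := rfl
    rw [this, map_sub, LinearMap.trace_smulRight, LinearMap.trace_smulRight,
      LinearMap.comp_apply, LinearMap.comp_apply, h.symm (I e), ← neg_neg (g e _), ← hS.skew]
    ring
  change ∑ i, ∑ j, LinearMap.trace ℝ V (nullCurv g I e (b i) (b j) * R (d i) (d j)) = _
  simp only [e1, Finset.sum_sub_distrib, e2]
  rw [hR.swap e (I e), mul_neg, map_neg, e3]
  ring

/-- The pairing embeds `M` into the dual of `N`, so `dim M ≤ dim N`. -/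
theorem _root_.Submodule.le_of_separating {W : Type*} [AddCommGroup W] [Module ℝ W]
    [FiniteDimensional ℝ W] (β : W →ₗ[ℝ] W →ₗ[ℝ] ℝ) {M N : Submodule ℝ W} (hNM : N ≤ M)
    (hβ : ∀ x ∈ M, (∀ y ∈ N, β y x = 0) → x = 0) : M ≤ N := by
  let φ : M →ₗ[ℝ] Module.Dual ℝ N := N.subtype.dualMap ∘ₗ β.flip ∘ₗ M.subtype
  have hφ : Function.Injective φ := by
    refine (injective_iff_map_eq_zero φ).2 fun x hx => Subtype.ext (hβ x x.2 fun y hy => ?_)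
    exact LinearMap.congr_fun hx ⟨y, hy⟩
  have hle := LinearMap.finrank_le_finrank_of_injective hφ
  rw [Subspace.dual_finrank_eq] at hle
  exact (Submodule.eq_of_le_of_finrank_le hNM hle).ge

/-- A nonzero space of curvature tensors of type `sp(n, ℝ)` which is stable under the nilpotent
elements `nullEnd g I e` contains all curvature tensors of this type. -/
theorem HermitianPair.mem_of_ne_bot [FiniteDimensional ℝ V] (h : HermitianPair g I P)
    (hg : g.Nondegenerate) {L : LieSubalgebra ℝ (Module.End ℝ V)}
    (hL : ∀ e, P e = e → nullEnd g I e ∈ L) (M : Submodule ℝ (Curv V))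
    (hM : ∀ R, R ∈ M → IsSymplecticCurvature g I P R) (N : LieSubmodule ℝ L (Curv V))
    (hNM : N.toSubmodule ≤ M) (hN : N.toSubmodule ≠ ⊥) : M ≤ N.toSubmodule := by
  have step : ∀ R ∈ N, ∀ e, P e = e → g (R e (I e) e) (I e) ≠ 0 → nullCurv g I e ∈ N := by
    intro R hR e he hne
    have h1 := (hM R (hNM hR)).lie_nullEnd_pow_four h he (L := L) ⟨_, hL e he⟩ rfl
    have h2 : (24 * g (R e (I e) e) (I e)) • nullCurv g I e ∈ N.toSubmodule := by
      rw [← h1]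
      exact N.lie_mem (N.lie_mem (N.lie_mem (N.lie_mem hR)))
    exact (N.toSubmodule.smul_mem_iff (mul_ne_zero (by norm_num) hne)).1 h2
  have step' : ∀ e f, P e = e → P f = f → nullCurv g I e ∈ N → g (I e) f ≠ 0 →
      nullCurv g I f ∈ N := by
    intro e f he hf heN hne
    refine step _ heN f hf ?_
    rw [h.nullCurv_quartic he hf]
    exact pow_ne_zero 4 hne
  obtain ⟨R, hR, hR0⟩ := (Submodule.ne_bot_iff _).1 hN
  obtain ⟨e, he, hne⟩ : ∃ e, P e = e ∧ g (R e (I e) e) (I e) ≠ 0 := by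
    by_contra! hc
    exact hR0 ((hM R (hNM hR)).eq_zero_of_quartic h hc)
  have heN := step R hR e he hne
  have he0 : e ≠ 0 := by
    rintro rfl
    simp at hne
  have hall : ∀ f, P f = f → nullCurv g I f ∈ N := by
    intro f hf
    by_cases hf0 : f = 0
    · have : nullCurv g I f = 0 := by
        subst hf0
        ext x y z
        simp [nullCurv_apply, nullEnd_apply]
      rw [this]
      exact N.zero_mem
    · obtain ⟨u, hu, hu1⟩ := h.exists_form_eq_one he he0
      obtain ⟨v, hv, hv1⟩ := h.exists_form_eq_one hf hf0
      -- If `ω(e, f) = 0`, the passage from `e⁴` to `f⁴` needs an intermediate vector, which exists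
      -- because two proper subspaces do not cover `E`.
      obtain ⟨w, hw, hw1, hw2⟩ : ∃ w, P w = w ∧ g (I e) w ≠ 0 ∧ g (I f) w ≠ 0 := by
        by_cases h1 : g (I f) u = 0
        · by_cases h2 : g (I e) v = 0
          · exact ⟨u + v, by rw [map_add, hu, hv], by simp [hu1, h2], by simp [hv1, h1]⟩
          · exact ⟨v, hv, h2, by simp [hv1]⟩
        · exact ⟨u, hu, by simp [hu1], h1⟩
      refine step' w f hw hf (step' e w he hw heN hw1) ?_
      rw [h.form_skew]
      exact neg_ne_zero.2 hw2
  refine Submodule.le_of_separating (W := Curv V) (contraction hg) hNM fun Q hQ hQN => ?_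
  refine (hM Q hQ).eq_zero_of_quartic h fun f hf => ?_
  have h1 := hQN _ (hall f hf)
  rw [(hM Q hQ).contraction_nullCurv h hg] at h1
  linarith

/-- A criterion for irreducibility. -/
theorem isIrreducibleSubmodule_of {L : LieSubalgebra ℝ (Module.End ℝ V)}
    {M : Submodule ℝ (Curv V)} (hlie : ∀ (A : L), ∀ R ∈ M, ⁅A, R⁆ ∈ M) (hne : M ≠ ⊥)
    (hsimple : ∀ N : LieSubmodule ℝ L (Curv V), N.toSubmodule ≤ M → N.toSubmodule ≠ ⊥ →
      M ≤ N.toSubmodule) : IsIrreducibleSubmodule L M := by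
  let M' : LieSubmodule ℝ L (Curv V) := { M with lie_mem := fun {A R} hR => hlie A R hR }
  refine ⟨M', rfl, ?_⟩
  obtain ⟨R₀, hR₀, hR₀0⟩ := (Submodule.ne_bot_iff _).1 hne
  have : Nontrivial M' := ⟨⟨R₀, hR₀⟩, 0, fun h => hR₀0 (congrArg Subtype.val h)⟩
  refine { exists_pair_ne := exists_pair_ne _, eq_bot_or_eq_top := fun N => ?_ }
  by_cases hN : N = ⊥
  · exact Or.inl hN
  · right
    obtain ⟨Q, hQ, hQ0⟩ := (Submodule.ne_bot_iff _).1 fun h => hN ((LieSubmodule.toSubmodule_eq_bot N).1 h)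
    have h1 := hsimple (N.map M'.incl)
      (by
        rintro _ ⟨Q, -, rfl⟩
        exact Q.2)
      (fun h => hQ0 (Subtype.ext ((Submodule.eq_bot_iff _).1 h Q.1 ⟨Q, hQ, rfl⟩)))
    refine top_le_iff.1 fun Q _ => ?_
    obtain ⟨Q', hQ', hQQ⟩ := h1 Q.2
    have hQ2 : Q' = Q := Subtype.ext hQQ
    rwa [← hQ2]

end Irreducibility

/-! ### Assembling the decomposition -/

section Main

variable {V : Type*} [AddCommGroup V] [Module ℝ V]
variable {g : LinearMap.BilinForm ℝ V} {G : LieSubalgebra ℝ (Module.End ℝ V)}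
  {J : Fin 3 → Module.End ℝ V}

/-- The `G`-part of `A` commutes with `sp(H)`, so `sp(H)` is an ideal of `sp(G)`. -/
theorem Corresponds.lie_mem_spH (hJ : Corresponds G J) (h : HermitianPair g (J 0) (J 1))
    {x₀ y₀ : V} (hne : g x₀ y₀ ≠ 0) {A B : Module.End ℝ V} (hA : A ∈ spG g G)
    (hB : B ∈ spH g G J) : ⁅A, B⁆ ∈ spH g G J := by
  obtain ⟨S, a, b, d, hS, rfl⟩ := hJ.exists_decomposition h hne hA
  have hBS := (hJ.mem_spH_iff B).1 hB
  have e : ⁅S + a • J 0 + b • J 1 + d • (J 0 * J 1), B⁆ = ⁅S, B⁆ := by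
    refine LinearMap.ext fun x => ?_
    simp [Ring.lie_def, hBS.comm_I, hBS.comm_P]
  rw [e]
  exact (spH g G J).lie_mem ((hJ.mem_spH_iff S).2 hS) hB

/-- The curvature tensors with values in an ideal of `L` form an `L`-submodule. -/
theorem lie_mem_curvatureTensors {L K : LieSubalgebra ℝ (Module.End ℝ V)}
    (hK : ∀ A ∈ L, ∀ B ∈ K, ⁅A, B⁆ ∈ K) (A : L) {R : Curv V} (hR : R ∈ curvatureTensors K) :
    ⁅A, R⁆ ∈ curvatureTensors K := by
  obtain ⟨h1, h2, h3⟩ := hR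
  have hs : ∀ x y z, R x y z = -R y x z := fun x y z => by
    have := LinearMap.congr_fun (h1 (x + y)) z
    simp only [map_add, LinearMap.add_apply, h1, zero_add, add_zero,
      LinearMap.zero_apply] at this
    exact eq_neg_of_add_eq_zero_right this
  refine ⟨fun x => LinearMap.ext fun z => ?_, fun x y => ?_, fun x y z => ?_⟩
  · rw [lie_curv_apply, h1, hs x (A.1 x)]
    simp
  · have e : ⁅A, R⁆ x y = ⁅A.1, R x y⁆ - R (A.1 x) y - R x (A.1 y) := LinearMap.ext fun z => by
      rw [lie_curv_apply]
      simp only [Ring.lie_def, LinearMap.sub_apply, Module.End.mul_apply]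
      abel
    rw [e]
    exact K.sub_mem (K.sub_mem (hK _ A.2 _ (h2 x y)) (h2 _ _)) (h2 _ _)
  · have e := congrArg A.1 (h3 x y z)
    simp only [map_add, map_zero] at e
    simp only [lie_curv_apply]
    linear_combination (norm := module) e - h3 (A.1 x) y z - h3 x (A.1 y) z - h3 x y (A.1 z)

theorem Corresponds.exists_sub_mem [FiniteDimensional ℝ V] (hJ : Corresponds G J)
    (hG : IsHermitianParaQuaternionic g G) (h : HermitianPair g (J 0) (J 1))
    (hdim : 8 ≤ Module.finrank ℝ V) {x₀ y₀ : V} (hne : g x₀ y₀ ≠ 0) {R : Curv V}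
    (hR : R ∈ curvatureTensors (spG g G)) :
    ∃ c : ℝ, R - c • projectiveCurvature g J ∈ curvatureTensors (spH g G J) := by
  obtain ⟨h1, h2, h3⟩ := hR
  obtain ⟨c, hc⟩ := h.exists_coefficient hdim h1 (fun x y => ((mem_spG g G _).1 (h2 x y)).2) h3
    fun x y => hJ.exists_decomposition h hne (h2 x y)
  obtain ⟨k1, -, k3⟩ := hJ.projectiveCurvature_mem hG h
  -- Modulo `sp(H)`, `R` is `c` times the standard `G`-valued form and the projective tensor is `-2`
  -- times it.
  refine ⟨-(1 / 2) * c, fun x => ?_, fun x y => ?_, fun x y z => ?_⟩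
  · simp [h1, k1]
  · have e1 := (hJ.mem_spH_iff _).2 (hc x y)
    have e2 := (hJ.mem_spH_iff _).2 (hJ.isSymplectic_projectiveCurvature_add h x y)
    have e := (spH g G J).add_mem e1 ((spH g G J).smul_mem (1 / 2 * c) e2)
    convert e using 1
    simp only [LinearMap.sub_apply, LinearMap.smul_apply]
    module
  · simp only [LinearMap.sub_apply, LinearMap.smul_apply]
    linear_combination (norm := module) h3 x y z + (1 / 2 * c) • k3 x y z

theorem Corresponds.isIrreducibleSubmodule_span (hJ : Corresponds G J)
    (h : HermitianPair g (J 0) (J 1)) {x₀ y₀ : V} (hne : g x₀ y₀ ≠ 0)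
    (h0 : projectiveCurvature g J ≠ 0) :
    IsIrreducibleSubmodule (spG g G) (Submodule.span ℝ {projectiveCurvature g J}) := by
  refine isIrreducibleSubmodule_of (fun A R hR => ?_) (mt Submodule.span_singleton_eq_bot.1 h0)
    fun N hNM hN => ?_
  · obtain ⟨c, rfl⟩ := Submodule.mem_span_singleton.1 hR
    obtain ⟨S, a, b, d, hS, hA⟩ := hJ.exists_decomposition h hne A.2
    have e : ⁅A, c • projectiveCurvature g J⁆ = 0 :=
      LinearMap.ext fun x => LinearMap.ext fun y => LinearMap.ext fun z => by
        have h1 := hJ.projectiveCurvature_invariant h hS a b d hA x y z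
        rw [lie_curv_apply]
        simp only [LinearMap.smul_apply, map_smul, ← smul_sub, h1, smul_zero,
          LinearMap.zero_apply]
    rw [e]
    exact Submodule.zero_mem _
  · obtain ⟨R, hR, hR0⟩ := (Submodule.ne_bot_iff _).1 hN
    obtain ⟨c, rfl⟩ := Submodule.mem_span_singleton.1 (hNM hR)
    have hc : c ≠ 0 := fun hc => hR0 (by rw [hc, zero_smul])
    rw [Submodule.span_singleton_le_iff_mem]
    exact (Submodule.smul_mem_iff _ hc).1 hR

theorem spH_le_autG (g : LinearMap.BilinForm ℝ V) (G : LieSubalgebra ℝ (Module.End ℝ V))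
    (J : Fin 3 → Module.End ℝ V) {A : Module.End ℝ V} (hA : A ∈ spH g G J) : A ∈ autG G :=
  hA.2.1

theorem curvatureTensors_mono {K L : LieSubalgebra ℝ (Module.End ℝ V)} (hKL : ∀ A ∈ K, A ∈ L) :
    curvatureTensors K ≤ curvatureTensors L :=
  fun _ hR => ⟨hR.1, fun x y => hKL _ (hR.2.1 x y), hR.2.2⟩

end Main
end ParaQuaternionic

theorem theorem4p2 {V : Type*} [AddCommGroup V] [Module ℝ V] [FiniteDimensional ℝ V]
    (n : ℕ) (hn : 2 ≤ n) (hdim : Module.finrank ℝ V = 4 * n)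
    (g : LinearMap.BilinForm ℝ V) (hsymm : g.IsSymm) (hnondeg : g.Nondegenerate)
    (G : LieSubalgebra ℝ (Module.End ℝ V))
    (hG : ParaQuaternionic.IsHermitianParaQuaternionic g G)
    (J : Fin 3 → Module.End ℝ V) (hJ : ParaQuaternionic.Corresponds G J) :
    (∀ R ∈ ParaQuaternionic.curvatureTensors (ParaQuaternionic.spG g G),
      ParaQuaternionic.ricci R =
        (ParaQuaternionic.scalarCurvature g hnondeg R / (4 * (n : ℝ))) • g) ∧
    (Submodule.span ℝ {ParaQuaternionic.projectiveCurvature g J} ⊔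
        ParaQuaternionic.curvatureTensors (ParaQuaternionic.spH g G J) =
      ParaQuaternionic.curvatureTensors (ParaQuaternionic.spG g G)) ∧
    Disjoint (Submodule.span ℝ {ParaQuaternionic.projectiveCurvature g J})
      (ParaQuaternionic.curvatureTensors (ParaQuaternionic.spH g G J)) ∧
    ParaQuaternionic.IsIrreducibleSubmodule (ParaQuaternionic.spG g G)
      (Submodule.span ℝ {ParaQuaternionic.projectiveCurvature g J}) ∧
    ParaQuaternionic.curvatureTensors (ParaQuaternionic.spH g G J) ≤
      ParaQuaternionic.weylPart G ∧
    ParaQuaternionic.IsIrreducibleSubmodule (ParaQuaternionic.spG g G)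
      (ParaQuaternionic.curvatureTensors (ParaQuaternionic.spH g G J)) := by
  open ParaQuaternionic in
  have h := hJ.hermitianPair hG hsymm hnondeg
  have hdim8 : 8 ≤ Module.finrank ℝ V := by omega
  have hn0 : (4 * (n : ℝ)) ≠ 0 := by
    have : (n : ℝ) ≠ 0 := by exact_mod_cast (by omega : n ≠ 0)
    positivity
  obtain ⟨e, he, he0⟩ := h.exists_fixed_ne_zero hdim8
  obtain ⟨f, hf, hef⟩ := h.exists_form_eq_one he he0
  have hne : g (J 0 e) f ≠ 0 := by rw [hef]; exact one_ne_zero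
  have hric : ∀ R ∈ curvatureTensors (spH g G J), ricci R = 0 := fun R hR =>
    (hJ.mem_curvatureTensors_spH_iff.1 hR).ricci_eq_zero h hnondeg
  have hsub : ∀ R ∈ curvatureTensors (spG g G),
      ∃ c : ℝ, R - c • projectiveCurvature g J ∈ curvatureTensors (spH g G J) :=
    fun R hR => hJ.exists_sub_mem hG h hdim8 hne hR
  have hproj : ∀ c : ℝ, ricci (c • projectiveCurvature g J) = 0 → c = 0 := fun c hc => by
    rw [map_smul, hJ.ricci_projectiveCurvature h] at hc
    have h1 := LinearMap.congr_fun (LinearMap.congr_fun hc (J 0 e)) f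
    have h2 : (Module.finrank ℝ V + 8 : ℝ) ≠ 0 := by positivity
    simpa [hef, h2] using h1
  have hproj0 : projectiveCurvature g J ≠ 0 := fun h0 =>
    one_ne_zero (hproj 1 (by rw [h0, smul_zero, map_zero]))
  refine ⟨fun R hR => ?_, le_antisymm (sup_le ?_ ?_) fun R hR => ?_, ?_, ?_, fun R hR => ?_, ?_⟩
  · obtain ⟨c, hc⟩ := hsub R hR
    have h1 : ricci R = (c * (Module.finrank ℝ V + 8 : ℝ)) • g := by
      rw [← sub_add_cancel R (c • projectiveCurvature g J), map_add, hric _ hc, zero_add,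
        map_smul, hJ.ricci_projectiveCurvature h, smul_smul]
    rw [scalarCurvature_of_ricci_eq hnondeg h1, h1, hdim]
    push_cast
    rw [mul_div_assoc, div_self hn0, mul_one]
  · rw [Submodule.span_singleton_le_iff_mem]
    exact hJ.projectiveCurvature_mem hG h
  · exact curvatureTensors_mono fun A hA => hA.2
  · obtain ⟨c, hc⟩ := hsub R hR
    rw [← add_sub_cancel (c • projectiveCurvature g J) R]
    exact Submodule.add_mem_sup (Submodule.smul_mem _ _ (Submodule.mem_span_singleton_self _)) hc
  · refine Submodule.disjoint_def.2 fun R hR hR' => ?_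
    obtain ⟨c, rfl⟩ := Submodule.mem_span_singleton.1 hR
    rw [hproj c (hric _ hR'), zero_smul]
  · exact hJ.isIrreducibleSubmodule_span h hne hproj0
  · exact ⟨curvatureTensors_mono (fun A hA => spH_le_autG g G J hA) hR, hric R hR⟩
  · refine isIrreducibleSubmodule_of
      (fun A R hR => lie_mem_curvatureTensors (fun B hB C hC => hJ.lie_mem_spH h hne hB hC) A hR)
      ?_ fun N hNM hN => ?_
    -- The tensor `e⁴` is nonzero, as its quartic form takes the value `ω(e, f)⁴ = 1` at `f`.
    · have h1 := h.isSymplecticCurvature_nullCurv he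
      refine (Submodule.ne_bot_iff _).2 ⟨_, hJ.mem_curvatureTensors_spH_iff.2 h1, fun h0 => ?_⟩
      have h2 := h.nullCurv_quartic he hf
      simp [h0, hef] at h2
    · exact h.mem_of_ne_bot hnondeg
        (fun e he => ((hJ.mem_spH_iff _).2 (h.isSymplectic_nullEnd he)).2) _
        (fun R hR => hJ.mem_curvatureTensors_spH_iff.1 hR) N hNM hN
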